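/- All spaces are completely regular Hausdorff. Notation. For a commutative ring $A$ with $1$, an ideal is dense if its only annihilator in $A$ is $0$; $\mathcal{Q}(A)=\varinjlim_D \operatorname{Hom}_A(D,A)$ ($D$ ranging over all dense ideals, multiplication being composition) is the maximal ring of quotients of $A$; $\mathfrak{M}(A)$ is the space of maximal ideals of $A$ with the Stone (hull-kernel) topology; and $E(A)$ is the Boolean ring of idempotents of $A$, with the multiplication of $A$ and with addition $e\dotplus f=e+f-2ef$. For a space $X$, $Q(X)=\mathcal{Q}(C(X))$, where $C(X)$ is the ring of continuous real-valued functions on $X$; $\mathcal{B}(X)$ is the Boolean algebra of regular open subsets of $X$; and $$K(X)=\varprojlim_{S}\beta S,$$ where $S$ ranges over all dense $G_\delta$-subsets of the Stone–Čech compactification $\beta X$ and the bonding maps are the continuous extensions $\beta S\to\beta T$ of the inclusions $S\subset T$. Let $B_\infty$ be the free Boolean algebra on countably infinitely many generators, regarded as a Boolean ring. Theorem. (1) For every space $X$, the space $K(X)$ is compact Hausdorff and extremally disconnected, and $\mathfrak{M}(\mathcal{B}(X))$ is homeomorphic to $K(X)$. (2) For every nonempty space $X$ that has a countable base and no isolated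 points, $E(Q(X))\cong\mathcal{Q}(B_\infty)$ as rings, $\mathfrak{M}(Q(X))$ is homeomorphic to $\mathfrak{M}(\mathcal{Q}(B_\infty))$, and $\mathfrak{M}(Q(X))$ is homeomorphic to $K(X)$. (3) Hence $E(Q(X))$ and $\mathfrak{M}(Q(X))$ are, up to isomorphism and homeomorphism respectively, the same for all nonempty spaces $X$ that have a countable base and no isolated points. (4) $\mathcal{Q}(B_\infty)$ is the completion of $B_\infty$: it is a complete Boolean algebra (ordered by $a\le b$ iff $ab=a$), and the canonical homomorphism $B_\infty\to\mathcal{Q}(B_\infty)$ is injective with order-dense image. -/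

import Mathlib

universe u v

open TopologicalSpace

/-! ### The maximal ring of quotients of a commutative ring -/

/-- An ideal is (rationally) dense if its only annihilator is `0`. -/
def Ideal.IsRationallyDense {A : Type u} [CommRing A] (D : Ideal A) : Prop :=
  ∀ a : A, (∀ d ∈ D, a * d = 0) → a = 0

/-- An `A`-homomorphism `D → A` defined on a dense ideal `D` of `A`. -/
structure DenseHom (A : Type u) [CommRing A] where
  dom : Ideal A
  dense : dom.IsRationallyDense
  hom : dom →ₗ[A] A

namespace DenseHom

variable {A : Type u} [CommRing A]

theorem dense_mul {D E : Ideal A} (hD : D.IsRationallyDense) (hE : E.IsRationallyDense)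
    (a : A) (h : ∀ d ∈ D, ∀ e ∈ E, a * (d * e) = 0) : a = 0 := by
  refine hD a fun d hd => hE (a * d) fun e he => ?_
  rw [mul_assoc]
  exact h d hd e he

theorem dense_inf {D E : Ideal A} (hD : D.IsRationallyDense) (hE : E.IsRationallyDense) :
    (D ⊓ E).IsRationallyDense := fun a h =>
  dense_mul hD hE a fun d hd e he => h (d * e) ⟨D.mul_mem_right e hd, E.mul_mem_left d he⟩

theorem hom_smul (f : DenseHom A) (a : A) {x : A} (hx : x ∈ f.dom) :
    f.hom ⟨a * x, f.dom.mul_mem_left a hx⟩ = a * f.hom ⟨x, hx⟩ := by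
  rw [← smul_eq_mul a (f.hom _), ← map_smul]
  rfl

theorem hom_mul_comm (f : DenseHom A) {x y : A} (hx : x ∈ f.dom) (hy : y ∈ f.dom) :
    f.hom ⟨x, hx⟩ * y = f.hom ⟨y, hy⟩ * x := by
  rw [mul_comm _ y, mul_comm _ x, ← hom_smul f y hx, ← hom_smul f x hy]
  congr 2
  exact mul_comm y x

/-- Two homomorphisms are identified if they agree wherever both are defined. -/
def Rel (f g : DenseHom A) : Prop :=
  ∀ (x : A) (hf : x ∈ f.dom) (hg : x ∈ g.dom), f.hom ⟨x, hf⟩ = g.hom ⟨x, hg⟩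

/-- It suffices to agree on the products of elements of two dense ideals. -/
theorem Rel.of_mul {f g : DenseHom A} {D E : Ideal A} (hD : D.IsRationallyDense)
    (hE : E.IsRationallyDense)
    (h : ∀ d ∈ D, ∀ e ∈ E, ∃ (hf : d * e ∈ f.dom) (hg : d * e ∈ g.dom),
      f.hom ⟨d * e, hf⟩ = g.hom ⟨d * e, hg⟩) : Rel f g := by
  intro x hf hg
  refine sub_eq_zero.1 (dense_mul hD hE _ fun d hd e he => ?_)
  obtain ⟨h1, h2, h3⟩ := h d hd e he
  rw [sub_mul, hom_mul_comm f hf h1, hom_mul_comm g hg h2, h3, sub_self]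

instance setoid (A : Type u) [CommRing A] : Setoid (DenseHom A) where
  r := Rel
  iseqv :=
    { refl := fun _ _ _ _ => rfl
      symm := fun h x hf hg => (h x hg hf).symm
      trans := fun {f g k} h1 h2 => Rel.of_mul (dense_inf f.dense k.dense) g.dense
        fun d hd e he =>
          have hf := f.dom.mul_mem_right e hd.1
          have hk := k.dom.mul_mem_right e hd.2
          have hg := g.dom.mul_mem_left d he
          ⟨hf, hk, (h1 _ hf hg).trans (h2 _ hg hk)⟩ }

/-- Multiplication by `a`, defined on the whole ring. -/
def ofElem (a : A) : DenseHom A where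
  dom := ⊤
  dense := fun b h => by simpa using h 1 trivial
  hom := (LinearMap.mulLeft A a).comp (Submodule.subtype _)

/-- The sum, defined on the intersection of the domains. -/
def add (f g : DenseHom A) : DenseHom A where
  dom := f.dom ⊓ g.dom
  dense := dense_inf f.dense g.dense
  hom := f.hom.comp (Submodule.inclusion inf_le_left) +
    g.hom.comp (Submodule.inclusion inf_le_right)

/-- The negative, with the same domain. -/
def neg (f : DenseHom A) : DenseHom A where
  dom := f.dom
  dense := f.dense
  hom := -f.hom

/-- The composition `f ∘ g`, defined on all `x ∈ g.dom` such that `g x ∈ f.dom`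
(a set that contains the product `f.dom * g.dom`). -/
def comp (f g : DenseHom A) : DenseHom A where
  dom :=
    { carrier := {x | ∃ hx : x ∈ g.dom, g.hom ⟨x, hx⟩ ∈ f.dom}
      add_mem' := by
        rintro x y ⟨hx, hx'⟩ ⟨hy, hy'⟩
        refine ⟨add_mem hx hy, ?_⟩
        rw [show g.hom ⟨x + y, _⟩ = _ from g.hom.map_add ⟨x, hx⟩ ⟨y, hy⟩]
        exact add_mem hx' hy'
      zero_mem' := ⟨zero_mem _, by
        rw [show g.hom ⟨0, _⟩ = _ from g.hom.map_zero]
        exact zero_mem _⟩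
      smul_mem' := by
        rintro a x ⟨hx, hx'⟩
        refine ⟨g.dom.mul_mem_left a hx, ?_⟩
        rw [show g.hom ⟨a • x, _⟩ = _ from hom_smul g a hx]
        exact f.dom.mul_mem_left a hx' }
  dense := fun a h => dense_mul f.dense g.dense a fun d hd e he =>
    h (d * e) ⟨g.dom.mul_mem_left d he, by
      rw [hom_smul g d he]
      exact f.dom.mul_mem_right _ hd⟩
  hom :=
    { toFun := fun x => f.hom ⟨g.hom ⟨x.1, x.2.1⟩, x.2.2⟩
      map_add' := by
        rintro ⟨x, hx, hx'⟩ ⟨y, hy, hy'⟩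
        rw [← map_add]
        congr 1
        exact Subtype.ext (g.hom.map_add ⟨x, hx⟩ ⟨y, hy⟩)
      map_smul' := by
        rintro a ⟨x, hx, hx'⟩
        rw [RingHom.id_apply, ← map_smul]
        congr 1
        exact Subtype.ext (hom_smul g a hx) }

theorem comp_mem (f g : DenseHom A) {d e : A} (hd : d ∈ f.dom) (he : e ∈ g.dom) :
    d * e ∈ (comp f g).dom :=
  ⟨g.dom.mul_mem_left d he, by
    rw [hom_smul g d he]
    exact f.dom.mul_mem_right _ hd⟩

theorem comp_mem' (f g : DenseHom A) {d e : A} (hd : d ∈ f.dom) (he : e ∈ g.dom) :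
    e * d ∈ (comp f g).dom := by
  rw [mul_comm]
  exact comp_mem f g hd he

/-- On a product the composition is the product of the values. -/
theorem comp_apply (f g : DenseHom A) {d e : A} (hd : d ∈ f.dom) (he : e ∈ g.dom)
    (h : d * e ∈ (comp f g).dom) :
    (comp f g).hom ⟨d * e, h⟩ = f.hom ⟨d, hd⟩ * g.hom ⟨e, he⟩ := by
  change f.hom ⟨g.hom ⟨d * e, _⟩, _⟩ = _
  rw [mul_comm (f.hom _), ← hom_smul f _ hd]
  congr 2
  rw [hom_smul g d he, mul_comm]

theorem comp_comm (f g : DenseHom A) : Rel (comp f g) (comp g f) :=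
  Rel.of_mul f.dense g.dense fun d hd e he =>
    ⟨comp_mem f g hd he, comp_mem' g f he hd, by
      rw [comp_apply f g hd he, mul_comm, ← comp_apply g f he hd (comp_mem g f he hd)]
      congr 2
      exact mul_comm e d⟩

theorem comp_congr_left {f f' : DenseHom A} (g : DenseHom A) (h : Rel f f') :
    Rel (comp f g) (comp f' g) := by
  rintro x ⟨hx, hx1⟩ ⟨_, hx2⟩
  exact h _ hx1 hx2

theorem comp_congr_right (f : DenseHom A) {g g' : DenseHom A} (h : Rel g g') :
    Rel (comp f g) (comp f g') := by
  rintro x ⟨hx, hx1⟩ ⟨hx', hx2⟩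
  change f.hom ⟨g.hom ⟨x, _⟩, _⟩ = f.hom ⟨g'.hom ⟨x, _⟩, _⟩
  congr 2
  exact h _ _ _

end DenseHom

/-- The maximal ring of quotients of `A`: the direct limit of the modules `Hom (D, A)` over all
dense ideals `D`, where homomorphisms are multiplied by composition. -/
def MaxQuotientRing (A : Type u) [CommRing A] : Type u := Quotient (DenseHom.setoid A)

namespace MaxQuotientRing

variable {A : Type u} [CommRing A]

instance : Zero (MaxQuotientRing A) := ⟨⟦DenseHom.ofElem 0⟧⟩

instance : One (MaxQuotientRing A) := ⟨⟦DenseHom.ofElem 1⟧⟩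

instance : Add (MaxQuotientRing A) :=
  ⟨Quotient.map₂ DenseHom.add fun _ _ hf _ _ hg x h h' =>
    congrArg₂ (· + ·) (hf x h.1 h'.1) (hg x h.2 h'.2)⟩

instance : Neg (MaxQuotientRing A) :=
  ⟨Quotient.map DenseHom.neg fun _ _ hf x h h' => congrArg Neg.neg (hf x h h')⟩

instance : Mul (MaxQuotientRing A) :=
  ⟨Quotient.map₂ DenseHom.comp fun _ f' hf g _ hg =>
    (DenseHom.setoid A).trans (DenseHom.comp_congr_left g hf) (DenseHom.comp_congr_right f' hg)⟩

theorem mul_comm' (p q : MaxQuotientRing A) : p * q = q * p := by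
  induction p, q using Quotient.inductionOn₂ with
  | _ f g => exact Quotient.sound (DenseHom.comp_comm f g)

theorem mul_add' (p q r : MaxQuotientRing A) : p * (q + r) = p * q + p * r := by
  induction p, q, r using Quotient.inductionOn₃ with
  | _ f g k =>
    refine Quotient.sound fun x hx hy => ?_
    obtain ⟨h, h'⟩ := hx
    obtain ⟨⟨h1, h1'⟩, ⟨h2, h2'⟩⟩ := hy
    exact f.hom.map_add ⟨_, h1'⟩ ⟨_, h2'⟩

theorem one_mul' (p : MaxQuotientRing A) : 1 * p = p := by
  induction p using Quotient.inductionOn with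
  | _ f => exact Quotient.sound fun x _ hy => one_mul (f.hom ⟨x, hy⟩)

instance : CommRing (MaxQuotientRing A) where
  add_assoc p q r := by
    induction p, q, r using Quotient.inductionOn₃ with
    | _ f g k => exact Quotient.sound fun x _ _ => add_assoc _ _ _
  zero_add p := by
    induction p using Quotient.inductionOn with
    | _ f =>
      refine Quotient.sound fun x _ hy => ?_
      change 0 * x + f.hom ⟨x, hy⟩ = f.hom ⟨x, hy⟩
      rw [zero_mul, zero_add]
  add_zero p := by
    induction p using Quotient.inductionOn with
    | _ f =>
      refine Quotient.sound fun x _ hy => ?_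
      change f.hom ⟨x, hy⟩ + 0 * x = f.hom ⟨x, hy⟩
      rw [zero_mul, add_zero]
  add_comm p q := by
    induction p, q using Quotient.inductionOn₂ with
    | _ f g => exact Quotient.sound fun x _ _ => add_comm _ _
  neg_add_cancel p := by
    induction p using Quotient.inductionOn with
    | _ f =>
      refine Quotient.sound fun x hx _ => ?_
      change -f.hom ⟨x, hx.1⟩ + f.hom ⟨x, hx.2⟩ = 0 * x
      rw [zero_mul, neg_add_cancel]
  mul_assoc p q r := by
    induction p, q, r using Quotient.inductionOn₃ with
    | _ f g k => exact Quotient.sound fun x _ _ => rfl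
  mul_comm := mul_comm'
  left_distrib := mul_add'
  right_distrib p q r := by rw [mul_comm', mul_add', mul_comm' r, mul_comm' r]
  one_mul := one_mul'
  mul_one p := by rw [mul_comm', one_mul']
  zero_mul p := by
    induction p using Quotient.inductionOn with
    | _ f =>
      refine Quotient.sound fun x hx hy => ?_
      change 0 * f.hom ⟨x, hx.1⟩ = 0 * x
      rw [zero_mul, zero_mul]
  mul_zero p := by
    rw [mul_comm']
    induction p using Quotient.inductionOn with
    | _ f =>
      refine Quotient.sound fun x hx hy => ?_
      change 0 * f.hom ⟨x, hx.1⟩ = 0 * x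
      rw [zero_mul, zero_mul]
  nsmul := nsmulRec
  zsmul := zsmulRec

/-- The canonical homomorphism of `A` into its maximal ring of quotients. -/
def of (A : Type u) [CommRing A] : A →+* MaxQuotientRing A where
  toFun a := ⟦DenseHom.ofElem a⟧
  map_one' := rfl
  map_mul' a b := Quotient.sound fun x _ _ => mul_assoc a b x
  map_zero' := rfl
  map_add' a b := Quotient.sound fun x _ _ => add_mul a b x

end MaxQuotientRing

/-! ### Boolean rings -/

/-- The Boolean ring of all idempotents of `A`: the multiplication is that of `A`, and the sum of
`e` and `f` is `e + f - 2 * e * f` (the symmetric difference in the Boolean algebra of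
idempotents). -/
abbrev IdempotentRing (A : Type u) [CommRing A] : Type u := AsBoolRing {e : A // IsIdempotentElem e}

/-- The free Boolean algebra, regarded as a Boolean ring, with free generators indexed by `ι`: the
free commutative ring modulo the identities `p * p = p`. -/
abbrev FreeBooleanRing (ι : Type u) : Type u :=
  FreeCommRing ι ⧸ Ideal.span (Set.range fun p : FreeCommRing ι => p * p - p)

/-- The Boolean algebra of all regular open subsets of `X`, regarded as a Boolean ring. -/
abbrev RegularOpenRing (X : Type u) [TopologicalSpace X] : Type u :=
  AsBoolRing (Heyting.Regular (Opens X))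

/-- A homomorphism `j : B → C` of Boolean rings is a completion of `B` if it is injective, `C` is
complete with respect to the order given by `a ≤ b ↔ a * b = a`, and the image of `B` is
order-dense in `C`. -/
structure IsBooleanCompletion {B : Type u} {C : Type v} [CommRing B] [CommRing C]
    (j : B →+* C) : Prop where
  injective : Function.Injective j
  idempotent : ∀ c : C, c * c = c
  exists_sup : ∀ S : Set C, ∃ s : C, (∀ a ∈ S, a * s = a) ∧
    ∀ t : C, (∀ a ∈ S, a * t = a) → s * t = s
  dense : ∀ c : C, c ≠ 0 → ∃ b : B, b ≠ 0 ∧ j b * c = j b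

/-! ### The ring `Q(X)` and the space `K` -/

/-- The maximal ring of quotients `Q(X)` of the ring of all continuous real-valued functions. -/
abbrev QRing (X : Type u) [TopologicalSpace X] : Type u := MaxQuotientRing C(X, ℝ)

/-- The continuous extension `βS → βT` of the inclusion of `S` in `T`. -/
noncomputable def stoneCechInclusion {Y : Type u} [TopologicalSpace Y] {S T : Set Y}
    (h : S ⊆ T) : StoneCech S → StoneCech T :=
  stoneCechExtend (continuous_stoneCechUnit.comp (continuous_inclusion h))

/-- The inverse limit of the spaces `βS`, where `S` ranges over the dense `G_δ` subsets of `βX`. -/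
def KSpace (X : Type u) [TopologicalSpace X] : Type u :=
  {x : (S : {S : Set (StoneCech X) // IsGδ S ∧ Dense S}) → StoneCech S.1 //
    ∀ (S T : {S : Set (StoneCech X) // IsGδ S ∧ Dense S}) (h : S.1 ⊆ T.1),
      stoneCechInclusion h (x S) = x T}

instance (X : Type u) [TopologicalSpace X] : TopologicalSpace (KSpace X) :=
  inferInstanceAs (TopologicalSpace (Subtype _))

/-!
A complete Boolean algebra is determined by an order-dense subset, as a poset with bottom. For a
reduced ring `A`, the idempotents of `MaxQuotientRing A` form a complete Boolean algebra in which
`A \ {0}` has an order-dense image with `a` and `b` disjoint exactly if `a * b = 0`. For `A = C(X)`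
the cozero sets are order-dense in the regular open sets with the same disjointness relation, so
the idempotents of `Q(X)` are the regular open sets of `X`. If `X` is second countable without
isolated points, this algebra is complete and atomless and has a countable order-dense subset, and
so is the completion of the free Boolean ring on countably many generators; any two such algebras
are isomorphic, because each has an order-dense binary tree of successive splittings.

`Q(X)` is von Neumann regular, so its maximal ideals are determined by their idempotents and form
the Stone space of the regular open sets of `X`, or equivalently of `βX`. For every dense `S ⊆ βX`,
an ultrafilter of regular open sets has a limit in `βS`, and these limits identify the Stone space
with `K(X)`: the map is onto by compactness, and the ultrafilters that contain `c` or `cᶜ` are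
separated by the dense open set `S = c ∪ cᶜ`, on which the indicator of `c` is continuous.
-/

universe w

/-! ### Order-dense families in Boolean algebras -/

/-- A family of nonzero elements is order-dense if every nonzero element has a member of the family
below it. Families are used instead of subsets so that two dense subsets can be compared through a
common index type. -/
structure IsOrderDense {P α : Type*} [PartialOrder α] [OrderBot α] (j : P → α) : Prop where
  ne_bot : ∀ p, j p ≠ ⊥
  exists_le : ∀ a, a ≠ ⊥ → ∃ p, j p ≤ a

theorem disjoint_iff_of_isLUB {α : Type*} [BooleanAlgebra α] {s : Set α} {a b : α}
    (hb : IsLUB s b) : Disjoint a b ↔ ∀ x ∈ s, Disjoint a x := by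
  rw [disjoint_comm, ← le_compl_iff_disjoint_right, isLUB_le_iff hb]
  simp only [mem_upperBounds, le_compl_iff_disjoint_right, disjoint_comm (a := a)]

namespace IsOrderDense

variable {P α β : Type*} [BooleanAlgebra α] [BooleanAlgebra β] {j : P → α} {j' : P → β}

theorem le_iff (hj : IsOrderDense j) {a b : α} :
    a ≤ b ↔ ∀ p, Disjoint (j p) b → Disjoint (j p) a := by
  refine ⟨fun hab p hp => hp.mono_right hab, fun h => ?_⟩
  rw [← sdiff_eq_bot_iff]
  by_contra hne
  obtain ⟨p, hp⟩ := hj.exists_le _ hne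
  exact hj.ne_bot p ((h p (disjoint_sdiff_self_left.mono_left hp)).eq_bot_of_le
    (hp.trans sdiff_le))

theorem isLUB_image (hj : IsOrderDense j) (a : α) : IsLUB (j '' {p | j p ≤ a}) a := by
  refine ⟨by rintro _ ⟨p, hp, rfl⟩; exact hp, fun b hb => ?_⟩
  rw [← sdiff_eq_bot_iff]
  by_contra hne
  obtain ⟨p, hp⟩ := hj.exists_le _ hne
  exact hj.ne_bot p (le_bot_iff.1 (disjoint_sdiff_self_left hp
    (hb (Set.mem_image_of_mem j (hp.trans sdiff_le)))))

theorem exists_disjoint_iff (hj : IsOrderDense j) (hβ : ∀ s : Set β, ∃ b, IsLUB s b)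
    (h : ∀ p q, Disjoint (j p) (j q) ↔ Disjoint (j' p) (j' q)) (a : α) :
    ∃ b, ∀ p, Disjoint (j' p) b ↔ Disjoint (j p) a := by
  obtain ⟨b, hb⟩ := hβ (j' '' {p | j p ≤ a})
  refine ⟨b, fun p => ?_⟩
  simp only [disjoint_iff_of_isLUB hb, disjoint_iff_of_isLUB (hj.isLUB_image a),
    Set.forall_mem_image, h]

theorem nonempty_orderIso (hj : IsOrderDense j) (hj' : IsOrderDense j')
    (hα : ∀ s : Set α, ∃ a, IsLUB s a) (hβ : ∀ s : Set β, ∃ b, IsLUB s b)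
    (h : ∀ p q, Disjoint (j p) (j q) ↔ Disjoint (j' p) (j' q)) : Nonempty (α ≃o β) := by
  choose f hf using hj.exists_disjoint_iff hβ h
  choose g hg using hj'.exists_disjoint_iff hα fun p q => (h p q).symm
  have hgf (a : α) : g (f a) = a :=
    le_antisymm (hj.le_iff.2 fun p => by simp only [hg, hf, imp_self])
      (hj.le_iff.2 fun p => by simp only [hg, hf, imp_self])
  have hfg (b : β) : f (g b) = b :=
    le_antisymm (hj'.le_iff.2 fun p => by simp only [hg, hf, imp_self])
      (hj'.le_iff.2 fun p => by simp only [hg, hf, imp_self])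
  exact ⟨{ toFun := f, invFun := g, left_inv := hgf, right_inv := hfg
           map_rel_iff' := by
             simp only [Equiv.coe_fn_mk, hj'.le_iff, hf, hj.le_iff, implies_true] }⟩

end IsOrderDense

/-! ### The Cohen algebra -/

/-- The Cohen algebra: a nontrivial complete atomless Boolean algebra with a countable order-dense
family. -/
structure IsCohenAlgebra (α : Type*) [BooleanAlgebra α] : Prop where
  nontrivial : Nontrivial α
  exists_isLUB : ∀ s : Set α, ∃ a, IsLUB s a
  not_isAtom : ∀ a : α, ¬ IsAtom a
  exists_isOrderDense : ∃ d : ℕ → α, IsOrderDense d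

theorem IsOrderDense.isCohenAlgebra {P α : Type*} [BooleanAlgebra α] [Nontrivial α] [Countable P]
    {j : P → α} (hj : IsOrderDense j) (hα : ∀ s : Set α, ∃ a, IsLUB s a)
    (h : ∀ p, ∃ q r, j q ≤ j p ∧ j r ≤ j p ∧ Disjoint (j q) (j r)) : IsCohenAlgebra α where
  nontrivial := inferInstance
  exists_isLUB := hα
  not_isAtom a ha := by
    obtain ⟨p, hpa⟩ := hj.exists_le a ha.ne_bot
    obtain ⟨q, r, hqp, hrp, hqr⟩ := h p
    have eq_of_le {q} (hq : j q ≤ j p) : j q = a := (ha.le_iff.1 (hq.trans hpa)).resolve_left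
      (hj.ne_bot q)
    rw [eq_of_le hqp, eq_of_le hrp, disjoint_self] at hqr
    exact ha.ne_bot hqr
  exists_isOrderDense := by
    obtain ⟨p, -⟩ := hj.exists_le ⊤ top_ne_bot
    have : Nonempty P := ⟨p⟩
    obtain ⟨f, hf⟩ := exists_surjective_nat P
    exact ⟨j ∘ f, fun n => hj.ne_bot (f n), fun a ha => by
      simpa only [hf.exists, Function.comp_apply] using hj.exists_le a ha⟩

/-- A binary tree of successive partitions of the unit of a Boolean algebra into nonzero elements.
A node is a list of directions whose head is the last step, so that ancestors are suffixes. -/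
structure IsPartitionTree {α : Type*} [BooleanAlgebra α] (c : List Bool → α) : Prop where
  nil : c [] = ⊤
  ne_bot : ∀ l, c l ≠ ⊥
  disjoint_cons : ∀ l, Disjoint (c (true :: l)) (c (false :: l))
  sup_cons : ∀ l, c (true :: l) ⊔ c (false :: l) = c l

namespace IsPartitionTree

variable {α : Type*} [BooleanAlgebra α] {c : List Bool → α}

theorem le_of_isSuffix (hc : IsPartitionTree c) {l m : List Bool} (h : l <:+ m) : c m ≤ c l := by
  obtain ⟨t, rfl⟩ := h
  induction t with
  | nil => exact le_rfl
  | cons x t ih =>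
    refine le_trans ?_ ih
    rw [← hc.sup_cons (t ++ l), List.cons_append]
    cases x
    exacts [le_sup_right, le_sup_left]

theorem disjoint_cons_of_ne (hc : IsPartitionTree c) (l : List Bool) {x y : Bool} (h : x ≠ y) :
    Disjoint (c (x :: l)) (c (y :: l)) := by
  cases x <;> cases y <;> simp_all [hc.disjoint_cons, (hc.disjoint_cons l).symm]

theorem disjoint_of_not_isSuffix (hc : IsPartitionTree c) {l m : List Bool} (hlm : ¬ l <:+ m)
    (hml : ¬ m <:+ l) : Disjoint (c l) (c m) := by
  induction l with
  | nil => exact absurd m.nil_suffix hlm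
  | cons x l ih =>
    have hml' : ¬ m <:+ l := fun h => hml (h.trans (l.suffix_cons x))
    by_cases h : l <:+ m
    · obtain ⟨t, rfl⟩ := h
      rcases t.eq_nil_or_concat' with rfl | ⟨t, y, rfl⟩
      · exact absurd List.suffix_rfl hml'
      · have hy : y :: l <:+ t ++ [y] ++ l := ⟨t, by simp⟩
        have hxy : x ≠ y := by rintro rfl; exact hlm hy
        exact (hc.disjoint_cons_of_ne l hxy).mono_right (hc.le_of_isSuffix hy)
    · exact (ih h hml').mono_left (hc.le_of_isSuffix (l.suffix_cons x))

theorem disjoint_iff (hc : IsPartitionTree c) {l m : List Bool} :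
    Disjoint (c l) (c m) ↔ ¬ l <:+ m ∧ ¬ m <:+ l := by
  refine ⟨fun h => ⟨fun hlm => ?_, fun hml => ?_⟩, fun h => hc.disjoint_of_not_isSuffix h.1 h.2⟩
  · exact hc.ne_bot m (h.symm.eq_bot_of_le (hc.le_of_isSuffix hlm))
  · exact hc.ne_bot l (h.eq_bot_of_le (hc.le_of_isSuffix hml))

theorem exists_length_eq_and_not_disjoint (hc : IsPartitionTree c) {a : α} (ha : a ≠ ⊥) (n : ℕ) :
    ∃ l : List Bool, l.length = n ∧ ¬ Disjoint (c l) a := by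
  induction n with
  | zero => exact ⟨[], rfl, by rwa [hc.nil, top_disjoint]⟩
  | succ n ih =>
    obtain ⟨l, rfl, hl⟩ := ih
    rw [← hc.sup_cons l, disjoint_sup_left, not_and_or] at hl
    rcases hl with hl | hl
    exacts [⟨_, rfl, hl⟩, ⟨_, rfl, hl⟩]

end IsPartitionTree

/-- The binary tree with root `⊤` in which a node `a` of level `n` has the children `s a (d n)` and
`a \ s a (d n)`. -/
def splitTree {α : Type*} [BooleanAlgebra α] (s : α → α → α) (d : ℕ → α) : List Bool → α
  | [] => ⊤
  | true :: l => s (splitTree s d l) (d l.length)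
  | false :: l => splitTree s d l \ s (splitTree s d l) (d l.length)

namespace IsCohenAlgebra

variable {α β : Type*} [BooleanAlgebra α] [BooleanAlgebra β]

theorem exists_split (hα : IsCohenAlgebra α) {a : α} (ha : a ≠ ⊥) (e : α) :
    ∃ b, b ≠ ⊥ ∧ b < a ∧ (¬ Disjoint a e → b ≤ e) := by
  have exists_lt {x : α} (hx : x ≠ ⊥) : ∃ b, b ≠ ⊥ ∧ b < x := by
    by_contra! h
    exact hα.not_isAtom x ⟨hx, fun b hb => by_contra fun hb' => h b hb' hb⟩
  by_cases hae : Disjoint a e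
  · obtain ⟨b, hb, hba⟩ := exists_lt ha
    exact ⟨b, hb, hba, fun h => absurd hae h⟩
  · obtain ⟨b, hb, hba⟩ := exists_lt (mt disjoint_iff.2 hae)
    exact ⟨b, hb, hba.trans_le inf_le_left, fun _ => hba.le.trans inf_le_right⟩

theorem exists_isPartitionTree (hα : IsCohenAlgebra α) :
    ∃ c : List Bool → α, IsPartitionTree c ∧ IsOrderDense c := by
  have := hα.nontrivial
  obtain ⟨d, hd⟩ := hα.exists_isOrderDense
  choose! s hs_ne hs_lt hs_le using fun a ha => hα.exists_split (a := a) ha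
  have ne_bot (l : List Bool) : splitTree s d l ≠ ⊥ := by
    induction l with
    | nil => exact top_ne_bot
    | cons x l ih =>
      cases x
      · exact fun h => (hs_lt _ ih _).not_ge (sdiff_eq_bot_iff.1 h)
      · exact hs_ne _ ih _
  have hc : IsPartitionTree (splitTree s d) :=
    { nil := rfl
      ne_bot := ne_bot
      disjoint_cons := fun l => disjoint_sdiff_self_right
      sup_cons := fun l => sup_sdiff_cancel_right (hs_lt _ (ne_bot l) _).le }
  refine ⟨splitTree s d, hc, ne_bot, fun a ha => ?_⟩
  obtain ⟨n, hn⟩ := hd.exists_le a ha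
  obtain ⟨l, rfl, hl⟩ := hc.exists_length_eq_and_not_disjoint (hd.ne_bot n) n
  exact ⟨true :: l, (hs_le _ (ne_bot l) _ hl).trans hn⟩

theorem nonempty_orderIso (hα : IsCohenAlgebra α) (hβ : IsCohenAlgebra β) :
    Nonempty (α ≃o β) := by
  obtain ⟨c, hc, hc_dense⟩ := hα.exists_isPartitionTree
  obtain ⟨c', hc', hc'_dense⟩ := hβ.exists_isPartitionTree
  exact hc_dense.nonempty_orderIso hc'_dense hα.exists_isLUB hβ.exists_isLUB fun l m => by
    rw [hc.disjoint_iff, hc'.disjoint_iff]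

end IsCohenAlgebra

/-! ### Boolean rings of Boolean algebras -/

/-- An order isomorphism of Boolean algebras is an isomorphism of the associated Boolean rings. -/
def asBoolRingCongr {α β : Type*} [BooleanAlgebra α] [BooleanAlgebra β] (e : α ≃o β) :
    AsBoolRing α ≃+* AsBoolRing β where
  toEquiv := ofBoolRing.trans (e.toEquiv.trans toBoolRing)
  map_mul' a b := congrArg toBoolRing (e.map_inf (ofBoolRing a) (ofBoolRing b))
  map_add' a b := congrArg toBoolRing (map_symmDiff e (ofBoolRing a) (ofBoolRing b))

/-! ### Free Boolean rings -/

namespace FreeBooleanRing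

variable {ι : Type u} {B : Type v} [CommRing B]

theorem isIdempotentElem (x : FreeBooleanRing ι) : IsIdempotentElem x := by
  obtain ⟨y, rfl⟩ := Ideal.Quotient.mk_surjective x
  rw [IsIdempotentElem, ← map_mul, Ideal.Quotient.eq]
  exact Ideal.subset_span ⟨y, rfl⟩

instance [Countable ι] : Countable (FreeBooleanRing ι) :=
  Ideal.Quotient.mk_surjective.countable

/-- The free generators of the free Boolean ring. -/
noncomputable def gen (i : ι) : FreeBooleanRing ι := Ideal.Quotient.mk _ (FreeCommRing.of i)

/-- The homomorphism of the free Boolean ring into a Boolean ring with prescribed values on the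
generators. -/
noncomputable def lift (hB : ∀ b : B, IsIdempotentElem b) (f : ι → B) : FreeBooleanRing ι →+* B :=
  Ideal.Quotient.lift _ (FreeCommRing.lift f) fun a ha => by
    have hle : Ideal.span (Set.range fun p : FreeCommRing ι => p * p - p) ≤
        RingHom.ker (FreeCommRing.lift f) := by
      rw [Ideal.span_le]
      rintro _ ⟨p, rfl⟩
      rw [SetLike.mem_coe, RingHom.mem_ker, map_sub, map_mul, (hB _).eq, sub_self]
    exact hle ha

theorem lift_gen (hB : ∀ b : B, IsIdempotentElem b) (f : ι → B) (i : ι) :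
    lift hB f (gen i) = f i :=
  FreeCommRing.lift_of f i

instance : Nontrivial (FreeBooleanRing ι) :=
  (lift (B := ZMod 2) (by unfold IsIdempotentElem; decide) 0).domain_nontrivial

theorem exists_lift_update_gen_eq [Infinite ι] [DecidableEq ι] (x : FreeBooleanRing ι) :
    ∃ i, ∀ b, lift isIdempotentElem (Function.update gen i b) x = x := by
  obtain ⟨y, rfl⟩ := Ideal.Quotient.mk_surjective x
  obtain ⟨s, hs⟩ := FreeCommRing.exists_finset_support y
  obtain ⟨i, hi⟩ := Infinite.exists_notMem_finset s
  refine ⟨i, fun b => RingHom.eqOn_set_closure (f := (lift isIdempotentElem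
    (Function.update gen i b)).comp (Ideal.Quotient.mk _)) (g := Ideal.Quotient.mk _) ?_ hs⟩
  rintro _ ⟨k, hk, rfl⟩
  have hki : k ≠ i := fun h => hi (h ▸ hk)
  exact (lift_gen isIdempotentElem _ k).trans (Function.update_of_ne hki b gen)

theorem exists_orthogonal_mul_ne_zero [Infinite ι] {x : FreeBooleanRing ι} (hx : x ≠ 0) :
    ∃ b c, x * b ≠ 0 ∧ x * c ≠ 0 ∧ b * c = 0 := by
  classical
  obtain ⟨i, hi⟩ := exists_lift_update_gen_eq x
  have lift_gen_self (b : FreeBooleanRing ι) :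
      lift isIdempotentElem (Function.update gen i b) (gen i) = b := by
    rw [lift_gen, Function.update_self]
  refine ⟨gen i, 1 - gen i, fun h => hx ?_, fun h => hx ?_, ?_⟩
  · simpa only [map_mul, map_zero, hi, lift_gen_self, mul_one] using
      congrArg (lift isIdempotentElem (Function.update gen i 1)) h
  · simpa only [map_mul, map_sub, map_one, map_zero, hi, lift_gen_self, sub_zero, mul_one] using
      congrArg (lift isIdempotentElem (Function.update gen i 0)) h
  · rw [mul_one_sub, (isIdempotentElem _).eq, sub_self]

end FreeBooleanRing

/-! ### Idempotents of von Neumann regular rings -/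

theorem idempotent_disjoint_iff {R : Type*} [CommRing R] {e f : {e : R // IsIdempotentElem e}} :
    Disjoint e f ↔ (e : R) * f = 0 := by
  rw [disjoint_iff, Subtype.ext_iff]
  rfl

/-- A commutative ring is von Neumann regular if every element has a quasi-inverse. -/
def IsVonNeumannRegular (R : Type*) [CommRing R] : Prop := ∀ q : R, ∃ r, q * r * q = q

theorem IsVonNeumannRegular.exists_idempotent_dvd {R : Type*} [CommRing R]
    (hR : IsVonNeumannRegular R) (q : R) :
    ∃ e : {e : R // IsIdempotentElem e}, (e : R) ∣ q ∧ q ∣ e := by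
  obtain ⟨r, hr⟩ := hR q
  have he : IsIdempotentElem (q * r) := by rw [IsIdempotentElem, ← mul_assoc, hr]
  exact ⟨⟨q * r, he⟩, ⟨q, hr.symm⟩, dvd_mul_right q r⟩

/-- All elements of a Boolean ring are idempotent. -/
def idempotentRingEquiv {B : Type*} [CommRing B] (hB : ∀ b : B, IsIdempotentElem b) :
    IdempotentRing B ≃+* B where
  toFun e := (ofBoolRing e).1
  invFun b := toBoolRing ⟨b, hB b⟩
  map_mul' _ _ := rfl
  left_inv _ := rfl
  right_inv _ := rfl
  map_add' e f := by
    have add_self (b : B) : b + b = 0 := by linear_combination (hB (b + b)).eq - 4 * (hB b).eq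
    change (e.1 * (1 - f.1) + f.1 * (1 - e.1) - e.1 * (1 - f.1) * (f.1 * (1 - e.1)) : B) =
      e.1 + f.1
    linear_combination e.1 * (1 - e.1) * f.2.eq - add_self (e.1 * f.1)

/-! ### The maximal ring of quotients -/

theorem isReduced_of_forall_isIdempotentElem {A : Type*} [CommRing A]
    (hA : ∀ a : A, IsIdempotentElem a) : IsReduced A :=
  (isReduced_iff_pow_one_lt 2 one_lt_two).2 fun a ha => by rwa [sq, (hA a).eq] at ha

theorem eq_zero_of_mem_annihilator {A : Type*} [CommRing A] [IsReduced A] {I : Ideal A} {x : A}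
    (hx : x ∈ I) (hx' : x ∈ I.annihilator) : x = 0 :=
  sq_eq_zero_iff.1 ((sq x).trans (Submodule.mem_annihilator.1 hx' x hx))

theorem isRationallyDense_sup_inf_annihilator {A : Type u} [CommRing A] [IsReduced A]
    {D : Ideal A} (hD : D.IsRationallyDense) (I : Ideal A) :
    (I ⊔ D ⊓ I.annihilator).IsRationallyDense := by
  intro a ha
  have ha_mem : a ∈ I.annihilator :=
    Submodule.mem_annihilator.2 fun x hx => ha x (Ideal.mem_sup_left hx)
  refine hD a fun d hd => sq_eq_zero_iff.1 ?_
  have had : a * (a * d) = 0 := ha _ (Ideal.mem_sup_right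
    ⟨D.mul_mem_left a hd, I.annihilator.mul_mem_right d ha_mem⟩)
  rw [sq, mul_right_comm, had, zero_mul]

theorem isRationallyDense_sup_annihilator {A : Type u} [CommRing A] [IsReduced A] (I : Ideal A) :
    (I ⊔ I.annihilator).IsRationallyDense := by
  have h := isRationallyDense_sup_inf_annihilator (DenseHom.ofElem (1 : A)).dense I
  rwa [show (DenseHom.ofElem (1 : A)).dom = ⊤ from rfl, top_inf_eq] at h

namespace MaxQuotientRing

variable {A : Type u} [CommRing A]

/-- The class of a homomorphism that is defined on a dense ideal. -/
protected def mk (f : DenseHom A) : MaxQuotientRing A := Quotient.mk (DenseHom.setoid A) f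

theorem mk_surjective : Function.Surjective (MaxQuotientRing.mk (A := A)) := Quotient.mk_surjective

theorem mk_eq_mk {f g : DenseHom A} :
    MaxQuotientRing.mk f = MaxQuotientRing.mk g ↔ DenseHom.Rel f g := Quotient.eq

theorem of_injective : Function.Injective (of A) := fun a b h => by
  have hab : a * 1 = b * 1 := mk_eq_mk.1 h 1 trivial trivial
  rwa [mul_one, mul_one] at hab

theorem mk_mul_of (f : DenseHom A) {d : A} (hd : d ∈ f.dom) :
    MaxQuotientRing.mk f * of A d = of A (f.hom ⟨d, hd⟩) := by
  refine mk_eq_mk.2 fun x hx _ => ?_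
  change f.hom ⟨d * x, hx.2⟩ = f.hom ⟨d, hd⟩ * x
  rw [mul_comm (f.hom _), ← DenseHom.hom_smul]
  congr 2
  exact mul_comm d x

theorem eq_of_mul_of_eq {D : Ideal A} (hD : D.IsRationallyDense) {p q : MaxQuotientRing A}
    (h : ∀ d ∈ D, p * of A d = q * of A d) : p = q := by
  obtain ⟨f, rfl⟩ := mk_surjective p
  obtain ⟨g, rfl⟩ := mk_surjective q
  refine mk_eq_mk.2 (DenseHom.Rel.of_mul hD (DenseHom.dense_inf f.dense g.dense)
    fun d hd x hx => ⟨f.dom.mul_mem_left d hx.1, g.dom.mul_mem_left d hx.2, of_injective ?_⟩)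
  rw [← mk_mul_of f, ← mk_mul_of g, map_mul, ← mul_assoc, ← mul_assoc, h d hd]

theorem eq_of_mul_of_eq_of_sup {I J : Ideal A} (hIJ : (I ⊔ J).IsRationallyDense)
    {p q : MaxQuotientRing A} (hI : ∀ x ∈ I, p * of A x = q * of A x)
    (hJ : ∀ x ∈ J, p * of A x = q * of A x) : p = q := by
  refine eq_of_mul_of_eq hIJ fun d hd => ?_
  obtain ⟨x, hx, y, hy, rfl⟩ := Submodule.mem_sup.1 hd
  rw [map_add, mul_add, mul_add, hI x hx, hJ y hy]

theorem exists_mul_of_eq_of_ne_zero {e : MaxQuotientRing A} (he : IsIdempotentElem e)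
    (hne : e ≠ 0) : ∃ a, a ≠ 0 ∧ e * of A a = of A a := by
  obtain ⟨f, rfl⟩ := mk_surjective e
  by_contra! h
  refine hne (eq_of_mul_of_eq f.dense fun d hd => ?_)
  rw [zero_mul, mk_mul_of f hd, ← map_zero (of A)]
  refine congrArg _ (by_contra fun hfd => h _ hfd ?_)
  rw [← mk_mul_of f hd, ← mul_assoc, he.eq]

theorem isIdempotentElem (hA : ∀ a : A, IsIdempotentElem a) (q : MaxQuotientRing A) :
    IsIdempotentElem q := by
  obtain ⟨f, rfl⟩ := mk_surjective q
  set q := MaxQuotientRing.mk f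
  refine eq_of_mul_of_eq f.dense fun d hd => ?_
  calc q * q * of A d = (q * of A d) * (q * of A d) := by
        rw [mul_mul_mul_comm, ← map_mul, (hA d).eq]
    _ = q * of A d := by rw [mk_mul_of f hd, ← map_mul, (hA _).eq]

section Reduced

variable [IsReduced A]

theorem exists_extension (f : A →ₗ.[A] A) : ∃ q : MaxQuotientRing A,
    (∀ x : f.domain, q * of A x = of A (f x)) ∧
      ∀ a ∈ Submodule.annihilator f.domain, q * of A a = 0 := by
  let z : A →ₗ.[A] A := ⟨f.domain.annihilator, 0⟩
  have hfz (x : f.domain) (y : z.domain) (hxy : (x : A) = y) : f x = z y := by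
    have hx : x = 0 := Subtype.ext (eq_zero_of_mem_annihilator x.2 (hxy ▸ y.2))
    exact (congrArg f hx).trans f.map_zero
  let g : DenseHom A :=
    { dom := (f.sup z hfz).domain
      dense := isRationallyDense_sup_annihilator f.domain
      hom := (f.sup z hfz).toFun }
  refine ⟨MaxQuotientRing.mk g, fun x => ?_, fun a ha => ?_⟩
  · rw [mk_mul_of g (Ideal.mem_sup_left x.2)]
    exact congrArg _ ((f.left_le_sup z hfz).2 rfl).symm
  · rw [mk_mul_of g (Ideal.mem_sup_right ha), ← map_zero (of A)]
    exact congrArg _ ((f.right_le_sup z hfz).2 (x := ⟨a, ha⟩) rfl).symm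

theorem isVonNeumannRegular : IsVonNeumannRegular (MaxQuotientRing A) := by
  intro q
  obtain ⟨f, rfl⟩ := mk_surjective q
  let K : Ideal A := (LinearMap.ker f.hom).map f.dom.subtype
  let g : A →ₗ.[A] A :=
    ⟨f.dom ⊓ K.annihilator, f.hom.comp (Submodule.inclusion inf_le_left)⟩
  have hg : LinearMap.ker g.toFun = ⊥ := LinearMap.ker_eq_bot'.2 fun x hx =>
    Subtype.ext (eq_zero_of_mem_annihilator
      (Submodule.mem_map.2 ⟨⟨x, x.2.1⟩, hx, rfl⟩) x.2.2)
  obtain ⟨r, hr, -⟩ := exists_extension g.inverse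
  refine ⟨r, eq_of_mul_of_eq_of_sup (isRationallyDense_sup_inf_annihilator f.dense K) ?_ ?_⟩
  · rintro _ ⟨x, hx, rfl⟩
    have hfx : MaxQuotientRing.mk f * of A x = 0 := by
      rw [mk_mul_of f x.2, ← map_zero (of A)]
      exact congrArg _ hx
    rw [mul_assoc, Submodule.subtype_apply, hfx, mul_zero]
  · intro x hx
    have hgx : g ⟨x, hx⟩ ∈ g.inverse.domain := by
      rw [LinearPMap.inverse_domain]
      exact LinearMap.mem_range_self _ _
    have hrx : r * of A (g ⟨x, hx⟩) = of A x := by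
      rw [hr ⟨_, hgx⟩, LinearPMap.inverse_apply_eq hg (x := ⟨x, hx⟩) rfl]
    have hqx : MaxQuotientRing.mk f * of A x = of A (g ⟨x, hx⟩) := mk_mul_of f hx.1
    rw [mul_assoc, hqx, mul_assoc, hrx, hqx]

theorem exists_isLUB_idempotents (S : Set {e : MaxQuotientRing A // IsIdempotentElem e}) :
    ∃ e, IsLUB S e := by
  let I : Ideal A := Ideal.span {a | ∃ s ∈ S, (s : MaxQuotientRing A) * of A a = of A a}
  obtain ⟨e, he, he'⟩ := exists_extension ⟨I, I.subtype⟩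
  replace he (x : A) (hx : x ∈ I) : e * of A x = of A x := he ⟨x, hx⟩
  have he_idem : IsIdempotentElem e :=
    eq_of_mul_of_eq_of_sup (isRationallyDense_sup_annihilator I)
      (fun x hx => by rw [mul_assoc, he x hx, he x hx])
      fun x hx => by rw [mul_assoc, he' x hx, mul_zero]
  refine ⟨⟨e, he_idem⟩, fun s hs => ?_, fun t ht => ?_⟩
  · obtain ⟨f, hf⟩ := mk_surjective s.1
    refine eq_of_mul_of_eq f.dense fun d hd => ?_
    have hfd : f.hom ⟨d, hd⟩ ∈ I := Ideal.subset_span ⟨s, hs, by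
      rw [← mk_mul_of f hd, hf, ← mul_assoc, s.2.eq]⟩
    rw [mul_right_comm, ← hf, mk_mul_of f hd, mul_comm, he _ hfd]
  · have ht_mul (x : A) (hx : x ∈ I) : (t : MaxQuotientRing A) * of A x = of A x := by
      induction hx using Submodule.span_induction with
      | mem x hx =>
        obtain ⟨s, hs, hsx⟩ := hx
        have hst : (s : MaxQuotientRing A) * t = s := ht hs
        rw [← hsx, ← mul_assoc, mul_comm t.1, hst]
      | zero => rw [map_zero, mul_zero]
      | add x y _ _ hx hy => rw [map_add, mul_add, hx, hy]
      | smul a x _ hx => rw [smul_eq_mul, map_mul, mul_left_comm, hx]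
    refine eq_of_mul_of_eq_of_sup (isRationallyDense_sup_annihilator I)
      (fun x hx => ?_) fun x hx => ?_
    · rw [mul_assoc, ht_mul x hx]
    · rw [mul_right_comm, he' x hx, zero_mul]

theorem exists_isOrderDense_idempotents :
    ∃ j : {a : A // a ≠ 0} → {e : MaxQuotientRing A // IsIdempotentElem e},
      IsOrderDense j ∧ ∀ a b, Disjoint (j a) (j b) ↔ (a : A) * b = 0 := by
  choose supp supp_dvd dvd_supp using (isVonNeumannRegular (A := A)).exists_idempotent_dvd
  refine ⟨fun a => supp (of A a), ⟨fun a ha => a.2 (of_injective ?_), fun e he => ?_⟩,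
    fun a b => ?_⟩
  · have hsupp : (supp (of A a) : MaxQuotientRing A) = 0 := congrArg Subtype.val ha
    rw [map_zero, ← zero_dvd_iff, ← hsupp]
    exact supp_dvd _
  · obtain ⟨a, ha, hea⟩ := exists_mul_of_eq_of_ne_zero e.2 fun h => he (Subtype.ext h)
    obtain ⟨r, hr⟩ := dvd_supp (of A a)
    refine ⟨⟨a, ha⟩, ?_⟩
    change (supp (of A a) : MaxQuotientRing A) * e = supp (of A a)
    rw [hr, mul_comm, ← mul_assoc, hea]
  · rw [idempotent_disjoint_iff, ← (of_injective (A := A)).eq_iff, map_mul, map_zero,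
      ← zero_dvd_iff, ← zero_dvd_iff]
    exact ⟨fun h => h.trans (mul_dvd_mul (supp_dvd _) (supp_dvd _)),
      fun h => h.trans (mul_dvd_mul (dvd_supp _) (dvd_supp _))⟩

theorem nonempty_idempotents_orderIso {α : Type*} [BooleanAlgebra α]
    (hα : ∀ s : Set α, ∃ a, IsLUB s a) {j : {a : A // a ≠ 0} → α} (hj : IsOrderDense j)
    (h : ∀ a b, Disjoint (j a) (j b) ↔ (a : A) * b = 0) :
    Nonempty ({e : MaxQuotientRing A // IsIdempotentElem e} ≃o α) := by
  obtain ⟨i, hi, hi_disjoint⟩ := exists_isOrderDense_idempotents (A := A)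
  exact hi.nonempty_orderIso hj exists_isLUB_idempotents hα fun a b => by rw [hi_disjoint, h]

theorem isCohenAlgebra_idempotents [Countable A] [Nontrivial A]
    (hA : ∀ a : A, a ≠ 0 → ∃ b c, a * b ≠ 0 ∧ a * c ≠ 0 ∧ b * c = 0) :
    IsCohenAlgebra {e : MaxQuotientRing A // IsIdempotentElem e} := by
  obtain ⟨j, hj, hj_disjoint⟩ := exists_isOrderDense_idempotents (A := A)
  have : Nontrivial {e : MaxQuotientRing A // IsIdempotentElem e} :=
    ⟨⟨j ⟨1, one_ne_zero⟩, ⊥, hj.ne_bot _⟩⟩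
  have le_of_dvd {a b : {a : A // a ≠ 0}} (hab : (a : A) ∣ b) : j b ≤ j a :=
    hj.le_iff.2 fun c hc => by
      rw [hj_disjoint, ← zero_dvd_iff] at hc ⊢
      exact hc.trans (mul_dvd_mul_left _ hab)
  refine hj.isCohenAlgebra exists_isLUB_idempotents fun a => ?_
  obtain ⟨b, c, hab, hac, hbc⟩ := hA a a.2
  refine ⟨⟨_, hab⟩, ⟨_, hac⟩, le_of_dvd ⟨_, rfl⟩, le_of_dvd ⟨_, rfl⟩, ?_⟩
  rw [hj_disjoint, mul_mul_mul_comm, hbc, mul_zero]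

end Reduced

theorem isBooleanCompletion_of (hA : ∀ a : A, IsIdempotentElem a) :
    IsBooleanCompletion (of A) := by
  have := isReduced_of_forall_isIdempotentElem hA
  refine ⟨of_injective, fun c => isIdempotentElem hA c, fun S => ?_, fun c hc => ?_⟩
  · obtain ⟨e, he⟩ := exists_isLUB_idempotents (Subtype.val ⁻¹' S)
    exact ⟨e, fun a ha => he.1 (show ⟨a, isIdempotentElem hA a⟩ ∈ _ from ha), fun t ht =>
      he.2 (show ⟨t, isIdempotentElem hA t⟩ ∈ _ from fun a ha => ht a ha)⟩
  · obtain ⟨a, ha, hca⟩ := exists_mul_of_eq_of_ne_zero (isIdempotentElem hA c) hc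
    exact ⟨a, ha, by rw [mul_comm, hca]⟩

end MaxQuotientRing

/-! ### Regular open sets -/

section Regular

open Heyting.Regular (toRegular)

theorem disjoint_toRegular_iff {α : Type*} [HeytingAlgebra α] {a b : α} :
    Disjoint (toRegular a) (toRegular b) ↔ Disjoint a b := by
  have hcoe : Disjoint (toRegular a) (toRegular b) ↔ Disjoint aᶜᶜ bᶜᶜ := by
    rw [disjoint_iff, disjoint_iff]
    exact Heyting.Regular.coe_inj.symm
  rw [hcoe, disjoint_compl_compl_left_iff, disjoint_compl_compl_right_iff]

theorem exists_isLUB_regular {α : Type*} [Order.Frame α] (s : Set (Heyting.Regular α)) :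
    ∃ a, IsLUB s a :=
  ⟨_, Heyting.Regular.gi.isLUB_of_u_image (isLUB_sSup _)⟩

theorem IsOrderDense.toRegular {P α : Type*} [HeytingAlgebra α] {j : P → α}
    (hj : IsOrderDense j) : IsOrderDense fun p => toRegular (j p) where
  ne_bot p hp := hj.ne_bot p (disjoint_self.1 (disjoint_toRegular_iff.1 (disjoint_self.2 hp)))
  exists_le a ha := by
    obtain ⟨p, hp⟩ := hj.exists_le (a : α) fun h => ha (Heyting.Regular.coe_injective h)
    exact ⟨p, (Heyting.Regular.gi.gc _ _).2 hp⟩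

end Regular

theorem isOrderDense_coe_ne_bot {α : Type*} [PartialOrder α] [OrderBot α] :
    IsOrderDense (Subtype.val : {a : α // a ≠ ⊥} → α) :=
  ⟨Subtype.prop, fun a ha => ⟨⟨a, ha⟩, le_rfl⟩⟩

theorem isOrderDense_comap {X : Type u} {Y : Type v} [TopologicalSpace X] [TopologicalSpace Y]
    {i : C(X, Y)} (hi : IsDenseInducing i) :
    IsOrderDense fun V : {V : Opens Y // V ≠ ⊥} => V.1.comap i where
  ne_bot V hV := by
    obtain ⟨x, hx⟩ := hi.dense.exists_mem_open V.1.isOpen ((Opens.ne_bot_iff_nonempty _).1 V.2)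
    exact (Opens.ne_bot_iff_nonempty (V.1.comap i)).2 ⟨x, hx⟩ hV
  exists_le U hU := by
    obtain ⟨V, hV, hVU⟩ := hi.isOpen_iff.1 U.isOpen
    refine ⟨⟨⟨V, hV⟩, fun h => hU (Opens.ext ?_)⟩, hVU.le⟩
    rw [← hVU, show V = ∅ from congrArg SetLike.coe h, Set.preimage_empty, Opens.coe_bot]

theorem nonempty_regularOpens_orderIso {X : Type u} {Y : Type v} [TopologicalSpace X]
    [TopologicalSpace Y] {i : C(X, Y)} (hi : IsDenseInducing i) :
    Nonempty (Heyting.Regular (Opens X) ≃o Heyting.Regular (Opens Y)) := by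
  refine (isOrderDense_comap hi).toRegular.nonempty_orderIso isOrderDense_coe_ne_bot.toRegular
    exists_isLUB_regular exists_isLUB_regular fun V W => ?_
  rw [disjoint_toRegular_iff, disjoint_toRegular_iff, disjoint_iff, ← map_inf]
  refine ⟨fun h => disjoint_iff.2 (not_not.1 fun hVW => ?_), fun h => ?_⟩
  · exact (isOrderDense_comap hi).ne_bot ⟨_, hVW⟩ h
  · rw [h.eq_bot, map_bot]

theorem isOrderDense_countableBasis (X : Type u) [TopologicalSpace X] [SecondCountableTopology X] :
    IsOrderDense fun U : countableBasis X =>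
      (⟨U, isOpen_of_mem_countableBasis U.2⟩ : Opens X) where
  ne_bot U := (Opens.ne_bot_iff_nonempty _).2 (nonempty_of_mem_countableBasis U.2)
  exists_le V hV := by
    obtain ⟨x, hx⟩ := (Opens.ne_bot_iff_nonempty V).1 hV
    obtain ⟨U, hU, -, hUV⟩ := (isBasis_countableBasis X).exists_subset_of_mem_open hx V.isOpen
    exact ⟨⟨U, hU⟩, hUV⟩

theorem exists_disjoint_opens_le {X : Type u} [TopologicalSpace X] [T2Space X]
    (hX : ∀ x : X, ¬ IsOpen ({x} : Set X)) {U : Opens X} (hU : U ≠ ⊥) :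
    ∃ V W : Opens X, V ≠ ⊥ ∧ W ≠ ⊥ ∧ V ≤ U ∧ W ≤ U ∧ Disjoint V W := by
  obtain ⟨x, hx⟩ := (Opens.ne_bot_iff_nonempty U).1 hU
  obtain ⟨y, hy, hyx⟩ : ∃ y ∈ U, y ≠ x := by
    by_contra! h
    exact hX x (Set.eq_singleton_iff_unique_mem.2 ⟨hx, h⟩ ▸ U.isOpen)
  obtain ⟨V, W, hV, hW, hyV, hxW, hVW⟩ := t2_separation hyx
  exact ⟨U ⊓ ⟨V, hV⟩, U ⊓ ⟨W, hW⟩, (Opens.ne_bot_iff_nonempty _).2 ⟨y, hy, hyV⟩,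
    (Opens.ne_bot_iff_nonempty _).2 ⟨x, hx, hxW⟩, inf_le_left, inf_le_left,
    Disjoint.mono (b := (⟨V, hV⟩ : Opens X)) (d := ⟨W, hW⟩) inf_le_right inf_le_right
      (Opens.coe_disjoint.1 hVW)⟩

theorem isCohenAlgebra_regularOpens {X : Type u} [TopologicalSpace X] [T2Space X]
    [SecondCountableTopology X] [Nonempty X] (hX : ∀ x : X, ¬ IsOpen ({x} : Set X)) :
    IsCohenAlgebra (Heyting.Regular (Opens X)) := by
  have : Nontrivial (Heyting.Regular (Opens X)) :=
    ⟨⊥, ⊤, fun h => bot_ne_top (congrArg Subtype.val h)⟩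
  have hj := isOrderDense_countableBasis X
  refine hj.toRegular.isCohenAlgebra exists_isLUB_regular fun U => ?_
  obtain ⟨V', W', hV', hW', hVU, hWU, hVW⟩ := exists_disjoint_opens_le hX (hj.ne_bot U)
  obtain ⟨V, hV⟩ := hj.exists_le V' hV'
  obtain ⟨W, hW⟩ := hj.exists_le W' hW'
  exact ⟨V, W, Heyting.Regular.toRegular.monotone (hV.trans hVU),
    Heyting.Regular.toRegular.monotone (hW.trans hWU), disjoint_toRegular_iff.2 (hVW.mono hV hW)⟩

instance {X R : Type*} [TopologicalSpace X] [TopologicalSpace R] [MonoidWithZero R]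
    [ContinuousMul R] [IsReduced R] : IsReduced C(X, R) where
  eq_zero := fun _ ⟨n, hn⟩ => ContinuousMap.ext fun x =>
    IsNilpotent.eq_zero ⟨n, DFunLike.congr_fun hn x⟩

/-- The open set of all points where `f` does not vanish (its cozero set). -/
def cozeroOpens {X : Type u} [TopologicalSpace X] (f : C(X, ℝ)) : Opens X :=
  ⟨{x | f x ≠ 0}, isOpen_ne_fun f.continuous continuous_const⟩

theorem cozeroOpens_eq_bot_iff {X : Type u} [TopologicalSpace X] {f : C(X, ℝ)} :
    cozeroOpens f = ⊥ ↔ f = 0 := by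
  simp only [← SetLike.coe_set_eq, Opens.coe_bot, Set.eq_empty_iff_forall_notMem,
    ContinuousMap.ext_iff, cozeroOpens, Opens.coe_mk, Set.mem_ofPred_eq, not_not,
    ContinuousMap.zero_apply]

theorem disjoint_cozeroOpens_iff {X : Type u} [TopologicalSpace X] {f g : C(X, ℝ)} :
    Disjoint (cozeroOpens f) (cozeroOpens g) ↔ f * g = 0 := by
  rw [← cozeroOpens_eq_bot_iff, disjoint_iff]
  refine iff_of_eq (congrArg (· = ⊥) (Opens.ext (Set.ext fun x => ?_)))
  exact mul_ne_zero_iff.symm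

theorem isOrderDense_cozeroOpens (X : Type u) [TopologicalSpace X] [CompletelyRegularSpace X] :
    IsOrderDense fun f : {f : C(X, ℝ) // f ≠ 0} => cozeroOpens f.1 where
  ne_bot f h := f.2 (cozeroOpens_eq_bot_iff.1 h)
  exists_le U hU := by
    obtain ⟨x, hx⟩ := (Opens.ne_bot_iff_nonempty U).1 hU
    obtain ⟨f, hfx, hfU⟩ :=
      CompletelyRegularSpace.exists_BCNN U.isOpen.isClosed_compl (Set.notMem_compl_iff.2 hx)
    refine ⟨⟨⟨fun y => f y, by fun_prop⟩, fun h => ?_⟩, fun y hy => ?_⟩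
    · exact one_ne_zero (hfx.symm.trans (NNReal.coe_eq_zero.1 (DFunLike.congr_fun h x)))
    · exact not_not.1 fun hyU => hy (NNReal.coe_eq_zero.2 (hfU y hyU))

theorem nonempty_idempotents_qRing_orderIso (X : Type u) [TopologicalSpace X]
    [CompletelyRegularSpace X] :
    Nonempty ({e : QRing X // IsIdempotentElem e} ≃o Heyting.Regular (Opens X)) := by
  refine MaxQuotientRing.nonempty_idempotents_orderIso exists_isLUB_regular
    (isOrderDense_cozeroOpens X).toRegular fun f g => ?_
  rw [disjoint_toRegular_iff, disjoint_cozeroOpens_iff]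

/-! ### Spaces of maximal ideals -/

section MaximalSpectrum

variable {R : Type u} {S : Type v} [CommRing R] [CommRing S]

/-- The basic open set of all maximal ideals that do not contain `a`; the analogue of
`PrimeSpectrum.basicOpen`. -/
def maximalBasicOpen (a : R) : Set (MaximalSpectrum R) := {M | a ∉ M.asIdeal}

theorem isTopologicalBasis_maximalBasicOpen :
    IsTopologicalBasis (Set.range (maximalBasicOpen : R → Set (MaximalSpectrum R))) := by
  have h := PrimeSpectrum.isTopologicalBasis_basic_opens.induced
    (MaximalSpectrum.toPrimeSpectrum (R := R))
  rwa [← Set.range_comp] at h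

theorem isOpen_maximalBasicOpen (a : R) : IsOpen (maximalBasicOpen a) :=
  isTopologicalBasis_maximalBasicOpen.isOpen ⟨a, rfl⟩

instance : CompactSpace (MaximalSpectrum R) where
  isCompact_univ := by
    rw [Topology.IsInducing.isCompact_iff ⟨rfl⟩ (f := MaximalSpectrum.toPrimeSpectrum),
      Set.image_univ]
    refine isCompact_of_finite_subcover fun U hU hcover => ?_
    obtain ⟨t, ht⟩ := isCompact_univ.elim_finite_subcover U hU fun p _ => by
      obtain ⟨m, hm, hpm⟩ := p.asIdeal.exists_le_maximal p.isPrime.ne_top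
      obtain ⟨i, hi⟩ := Set.mem_iUnion.1 (hcover ⟨⟨m, hm⟩, rfl⟩)
      exact Set.mem_iUnion.2 ⟨i, ((PrimeSpectrum.le_iff_specializes p _).1 hpm).mem_open (hU i) hi⟩
    exact ⟨t, (Set.subset_univ _).trans ht⟩

theorem continuous_maximalSpectrum_comap (e : R ≃+* S) : Continuous
    fun M : MaximalSpectrum S =>
      (⟨M.asIdeal.comap e, Ideal.comap_isMaximal_of_equiv e⟩ : MaximalSpectrum R) :=
  isTopologicalBasis_maximalBasicOpen.continuous_iff.2 <|
    Set.forall_mem_range.2 fun a => isOpen_maximalBasicOpen (e a)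

/-- The homeomorphism of spaces of maximal ideals induced by an isomorphism of rings. -/
def maximalSpectrumCongr (e : R ≃+* S) : MaximalSpectrum R ≃ₜ MaximalSpectrum S where
  toFun M := ⟨M.asIdeal.comap e.symm, Ideal.comap_isMaximal_of_equiv e.symm⟩
  invFun M := ⟨M.asIdeal.comap e, Ideal.comap_isMaximal_of_equiv e⟩
  left_inv M := MaximalSpectrum.ext (Ideal.comap_of_equiv (I := M.asIdeal) e)
  right_inv M := MaximalSpectrum.ext (Ideal.comap_of_equiv (I := M.asIdeal) e.symm)
  continuous_toFun := continuous_maximalSpectrum_comap e.symm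
  continuous_invFun := continuous_maximalSpectrum_comap e

end MaximalSpectrum

section StoneClopen

variable {α : Type*} [BooleanAlgebra α] {a b : α} {u : MaximalSpectrum (AsBoolRing α)}

/-- The clopen set of the Stone space of `α` that represents the element `a`. A maximal ideal `u`
belongs to it if `a ∉ u`, that is, if `a` belongs to the ultrafilter complementary to `u`. -/
def stoneClopen (a : α) : Set (MaximalSpectrum (AsBoolRing α)) := maximalBasicOpen (toBoolRing a)

theorem mem_stoneClopen_inf_iff : u ∈ stoneClopen (a ⊓ b) ↔ u ∈ stoneClopen a ∧ u ∈ stoneClopen b :=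
  (not_congr u.isMaximal.isPrime.mul_mem_iff_mem_or_mem).trans not_or

theorem mem_stoneClopen_top : u ∈ stoneClopen (⊤ : α) :=
  u.asIdeal.ne_top_iff_one.1 u.isMaximal.ne_top

theorem notMem_stoneClopen_bot : u ∉ stoneClopen (⊥ : α) := fun h => h u.asIdeal.zero_mem

theorem mem_stoneClopen_of_le (hu : u ∈ stoneClopen a) (hab : a ≤ b) : u ∈ stoneClopen b :=
  (mem_stoneClopen_inf_iff.1 (by rwa [inf_eq_left.2 hab])).2

theorem mem_stoneClopen_compl_iff : u ∈ stoneClopen aᶜ ↔ u ∉ stoneClopen a := by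
  refine ⟨fun hac ha => notMem_stoneClopen_bot (u := u) ?_, fun ha hac => ?_⟩
  · rw [← inf_compl_self a]
    exact mem_stoneClopen_inf_iff.2 ⟨ha, hac⟩
  · refine mem_stoneClopen_top (u := u) ?_
    rw [← symmDiff_compl_self a, toBoolRing_symmDiff]
    exact add_mem (not_not.1 ha) hac

theorem mem_stoneClopen_sup_iff :
    u ∈ stoneClopen (a ⊔ b) ↔ u ∈ stoneClopen a ∨ u ∈ stoneClopen b := by
  rw [← not_iff_not, not_or, ← mem_stoneClopen_compl_iff, ← mem_stoneClopen_compl_iff,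
    ← mem_stoneClopen_compl_iff, compl_sup, mem_stoneClopen_inf_iff]

theorem isTopologicalBasis_stoneClopen : IsTopologicalBasis
    (Set.range (stoneClopen : α → Set (MaximalSpectrum (AsBoolRing α)))) :=
  isTopologicalBasis_maximalBasicOpen (R := AsBoolRing α)

theorem isClopen_stoneClopen (a : α) : IsClopen (stoneClopen a) := by
  refine ⟨isOpen_compl_iff.1 ?_, isOpen_maximalBasicOpen _⟩
  rw [show (stoneClopen a)ᶜ = stoneClopen aᶜ from Set.ext fun u => mem_stoneClopen_compl_iff.symm]
  exact isOpen_maximalBasicOpen _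

theorem eq_of_forall_mem_stoneClopen {v : MaximalSpectrum (AsBoolRing α)}
    (h : ∀ a : α, u ∈ stoneClopen a → v ∈ stoneClopen a) : u = v := by
  have hvu : v.asIdeal ≤ u.asIdeal := fun a hav =>
    not_not.1 (mt (h (ofBoolRing a)) (not_not.2 hav))
  exact MaximalSpectrum.ext (v.isMaximal.eq_of_le u.isMaximal.ne_top hvu).symm

theorem nonempty_stoneClopen (ha : a ≠ ⊥) : (stoneClopen a).Nonempty := by
  have hunit : ¬ IsUnit (toBoolRing aᶜ) := fun h => ha (compl_eq_top.1 (toBoolRing_inj.1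
    (h.mul_left_cancel ((BooleanRing.mul_self _).trans (mul_one _).symm))))
  obtain ⟨M, hM, haM⟩ := exists_max_ideal_of_mem_nonunits hunit
  exact ⟨⟨M, hM⟩, not_not.1 (mt mem_stoneClopen_compl_iff.2 (not_not.2 haM))⟩

theorem extremallyDisconnected_maximalSpectrum (hα : ∀ s : Set α, ∃ a, IsLUB s a) :
    ExtremallyDisconnected (MaximalSpectrum (AsBoolRing α)) where
  open_closure W hW := by
    obtain ⟨s, hs⟩ := hα {a | stoneClopen a ⊆ W}
    suffices closure W = stoneClopen s from this ▸ (isClopen_stoneClopen s).isOpen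
    refine (closure_minimal (fun u hu => ?_) (isClopen_stoneClopen s).isClosed).antisymm
      fun u hu => isTopologicalBasis_stoneClopen.mem_closure_iff.2 (Set.forall_mem_range.2 ?_)
    · obtain ⟨_, ⟨a, rfl⟩, hua, haW⟩ :=
        isTopologicalBasis_stoneClopen.exists_subset_of_mem_open hu hW
      exact mem_stoneClopen_of_le hua (hs.1 haW)
    · intro b hub
      by_contra hbW
      have hbs : Disjoint b s := by
        refine (disjoint_iff_of_isLUB hs).2 fun a ha => disjoint_iff.2 (not_not.1 fun hne => ?_)
        obtain ⟨v, hv⟩ := nonempty_stoneClopen hne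
        rw [mem_stoneClopen_inf_iff] at hv
        exact hbW ⟨v, hv.1, ha hv.2⟩
      refine notMem_stoneClopen_bot (u := u) ?_
      rw [← hbs.eq_bot]
      exact mem_stoneClopen_inf_iff.2 ⟨hub, hu⟩

end StoneClopen

section IdempotentRing

variable {Q : Type u} [CommRing Q]

theorem isMaximal_of_mem_or_one_sub_mem {I : Ideal Q} (hI : (1 : Q) ∉ I)
    (h : ∀ x, x ∈ I ∨ 1 - x ∈ I) : I.IsMaximal := by
  refine Ideal.isMaximal_iff.2 ⟨hI, fun J x hIJ hx hxJ => ?_⟩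
  exact sub_add_cancel 1 x ▸ J.add_mem (hIJ ((h x).resolve_left hx)) hxJ

/-- The maximal ideal of the Boolean ring of idempotents that consists of all idempotents in a
maximal ideal `M`. -/
def idempotentsOf (M : MaximalSpectrum Q) : MaximalSpectrum (IdempotentRing Q) where
  asIdeal :=
    { carrier := {e | (ofBoolRing e).1 ∈ M.asIdeal}
      add_mem' := fun he hf => sub_mem
        (add_mem (M.asIdeal.mul_mem_right _ he) (M.asIdeal.mul_mem_right _ hf))
        (M.asIdeal.mul_mem_right _ (M.asIdeal.mul_mem_right _ he))
      zero_mem' := M.asIdeal.zero_mem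
      smul_mem' := fun e _ hf => M.asIdeal.mul_mem_left (ofBoolRing e).1 hf }
  isMaximal := by
    refine isMaximal_of_mem_or_one_sub_mem
      (fun h => M.isMaximal.ne_top ((Ideal.eq_top_iff_one _).2 h)) fun e => ?_
    change (ofBoolRing e).1 ∈ M.asIdeal ∨ (ofBoolRing (1 - e)).1 ∈ M.asIdeal
    rw [ofBoolRing_sub, ofBoolRing_one, top_symmDiff, hnot_eq_compl, IsIdempotentElem.coe_compl]
    refine M.isMaximal.isPrime.mem_or_mem ?_
    rw [(ofBoolRing e).2.mul_one_sub_self]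
    exact M.asIdeal.zero_mem

theorem idempotentsOf_surjective : Function.Surjective (idempotentsOf (Q := Q)) := by
  intro u
  let I : Ideal Q :=
    { carrier := {q | ∃ e : {e : Q // IsIdempotentElem e}, u ∉ stoneClopen e ∧ e * q = q}
      add_mem' := by
        rintro p q ⟨e, he, hep⟩ ⟨f, hf, hfq⟩
        refine ⟨e ⊔ f, mt mem_stoneClopen_sup_iff.1 (not_or.2 ⟨he, hf⟩), ?_⟩
        change (e.1 + f.1 - e.1 * f.1) * (p + q) = p + q
        linear_combination (1 - f.1) * hep + (1 - e.1) * hfq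
      zero_mem' := ⟨⊥, notMem_stoneClopen_bot, mul_zero _⟩
      smul_mem' := fun r q ⟨e, he, heq⟩ => ⟨e, he, by rw [smul_eq_mul, mul_left_comm, heq]⟩ }
  have hI : I ≠ ⊤ := fun h => by
    obtain ⟨e, he, he1⟩ := (Ideal.eq_top_iff_one I).1 h
    rw [mul_one] at he1
    rw [show e = ⊤ from Subtype.ext he1] at he
    exact he mem_stoneClopen_top
  obtain ⟨M, hM, hIM⟩ := Ideal.exists_le_maximal I hI
  have hle : u.asIdeal ≤ (idempotentsOf ⟨M, hM⟩).asIdeal := fun e he =>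
    hIM ⟨ofBoolRing e, not_not.2 he, (ofBoolRing e).2⟩
  exact ⟨⟨M, hM⟩, MaximalSpectrum.ext
    (u.isMaximal.eq_of_le (idempotentsOf ⟨M, hM⟩).isMaximal.ne_top hle).symm⟩

theorem continuous_idempotentsOf : Continuous (idempotentsOf (Q := Q)) :=
  isTopologicalBasis_maximalBasicOpen.continuous_iff.2 <|
    Set.forall_mem_range.2 fun e => isOpen_maximalBasicOpen (ofBoolRing e).1

theorem IsVonNeumannRegular.isInducing_idempotentsOf (hQ : IsVonNeumannRegular Q) :
    Topology.IsInducing (idempotentsOf (Q := Q)) := by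
  refine ⟨le_antisymm continuous_idempotentsOf.le_induced ((le_generateFrom ?_).trans_eq
    isTopologicalBasis_maximalBasicOpen.eq_generateFrom.symm)⟩
  refine Set.forall_mem_range.2 fun q => ?_
  obtain ⟨e, heq, hqe⟩ := hQ.exists_idempotent_dvd q
  refine isOpen_induced_iff.2 ⟨stoneClopen e, (isClopen_stoneClopen e).isOpen, Set.ext fun M => ?_⟩
  have heM : e.1 ∈ M.asIdeal ↔ q ∈ M.asIdeal :=
    ⟨M.asIdeal.mem_of_dvd heq, M.asIdeal.mem_of_dvd hqe⟩
  exact not_congr heM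

theorem IsVonNeumannRegular.nonempty_maximalSpectrum_homeomorph (hQ : IsVonNeumannRegular Q) :
    Nonempty (MaximalSpectrum Q ≃ₜ MaximalSpectrum (IdempotentRing Q)) :=
  ⟨(Equiv.ofBijective _ ⟨hQ.isInducing_idempotentsOf.injective,
    idempotentsOf_surjective⟩).toHomeomorphOfIsInducing hQ.isInducing_idempotentsOf⟩

end IdempotentRing

/-! ### Limits along ultrafilters of regular open sets -/

section RegularLimit

variable {S Y Z : Type*} [TopologicalSpace Y] [TopologicalSpace Z] {i : S → Y} {φ : S → Z}

/-- The filter on `Y` generated by the regular open sets that do not belong to the maximal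
ideal `u`. -/
def regularFilter (u : MaximalSpectrum (RegularOpenRing Y)) : Filter Y where
  sets := {s | ∃ c : Heyting.Regular (Opens Y), u ∈ stoneClopen c ∧ ((c : Opens Y) : Set Y) ⊆ s}
  univ_sets := ⟨⊤, mem_stoneClopen_top, Set.subset_univ _⟩
  sets_of_superset := fun ⟨c, hc, hcs⟩ hst => ⟨c, hc, hcs.trans hst⟩
  inter_sets := fun ⟨c, hc, hcs⟩ ⟨d, hd, hdt⟩ =>
    ⟨c ⊓ d, mem_stoneClopen_inf_iff.2 ⟨hc, hd⟩, Set.inter_subset_inter hcs hdt⟩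

variable {u : MaximalSpectrum (RegularOpenRing Y)} {c : Heyting.Regular (Opens Y)}

theorem eventually_mem_of_mem_stoneClopen (hu : u ∈ stoneClopen c) :
    ∀ᶠ x in (regularFilter u).comap i, i x ∈ (c : Opens Y) :=
  Filter.tendsto_comap.eventually ⟨c, hu, subset_rfl⟩

theorem neBot_comap_regularFilter (hi : DenseRange i) (u : MaximalSpectrum (RegularOpenRing Y)) :
    ((regularFilter u).comap i).NeBot := by
  refine Filter.comap_neBot fun s ⟨c, hc, hcs⟩ => ?_
  have hne : (c : Opens Y) ≠ ⊥ := fun h =>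
    notMem_stoneClopen_bot (u := u) (Heyting.Regular.coe_injective (a₂ := ⊥) h ▸ hc)
  obtain ⟨x, hx⟩ := hi.exists_mem_open c.1.isOpen ((Opens.ne_bot_iff_nonempty _).1 hne)
  exact ⟨x, hcs hx⟩

theorem mem_stoneClopen_of_mapClusterPt {z : Z} {W : Set Z} (hW : IsOpen W) (hz : z ∈ W)
    (hzφ : MapClusterPt z ((regularFilter u).comap i) φ)
    (hc : ∀ x, φ x ∈ W → i x ∈ (c : Opens Y)) : u ∈ stoneClopen c := by
  by_contra hu
  obtain ⟨x, hxW, hx⟩ := ((hzφ.frequently (hW.mem_nhds hz)).and_eventually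
    (eventually_mem_of_mem_stoneClopen (mem_stoneClopen_compl_iff.2 hu))).exists
  exact Set.disjoint_left.1 (Opens.coe_disjoint.2 disjoint_compl_right) (hc x hxW) hx

variable [TopologicalSpace S]

theorem exists_regular_preimage (hi : IsDenseInducing i) (hφ : Continuous φ) {W : Set Z}
    (hW : IsOpen W) : ∃ c : Heyting.Regular (Opens Y),
      (∀ x, φ x ∈ W → i x ∈ (c : Opens Y)) ∧ ∀ x, i x ∈ (c : Opens Y) → φ x ∈ closure W := by
  obtain ⟨V, hV, hVW⟩ := hi.isOpen_iff.1 (hW.preimage hφ)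
  refine ⟨Heyting.Regular.toRegular ⟨V, hV⟩, fun x hx => ?_, fun x hx => ?_⟩
  · exact (le_compl_compl : (⟨V, hV⟩ : Opens Y) ≤ _) (hVW.ge hx)
  · refine mem_closure_iff.2 fun N hN hxN => ?_
    obtain ⟨N', hN', hNN⟩ := hi.isOpen_iff.1 (hN.preimage hφ)
    have hmeet : (N' ∩ V).Nonempty := by
      by_contra h
      have hdisj : Disjoint (⟨N', hN'⟩ : Opens Y) ⟨V, hV⟩ :=
        disjoint_iff.2 (Opens.ext (Set.not_nonempty_iff_eq_empty.1 h))
      exact Set.disjoint_left.1 (Opens.coe_disjoint.2 hdisj.le_compl_right.disjoint_compl_right)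
        (hNN.ge hxN) hx
    obtain ⟨y, hyN, hyV⟩ := hi.dense.exists_mem_open (hN'.inter hV) hmeet
    exact ⟨φ y, hNN.le hyN, hVW.le hyV⟩

theorem exists_tendsto_comap_regularFilter [CompactSpace Z] [RegularSpace Z]
    (hi : IsDenseInducing i) (hφ : Continuous φ) (u : MaximalSpectrum (RegularOpenRing Y)) :
    ∃ z, Filter.Tendsto φ ((regularFilter u).comap i) (nhds z) := by
  have := neBot_comap_regularFilter hi.dense u
  obtain ⟨z, hz⟩ := exists_clusterPt_of_compactSpace (((regularFilter u).comap i).map φ)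
  refine ⟨z, fun N hN => Filter.mem_map.2 ?_⟩
  obtain ⟨V, hVz, hVc, hVN⟩ := exists_mem_nhds_isClosed_subset hN
  obtain ⟨c, hc, hcV⟩ := exists_regular_preimage hi hφ (isOpen_interior (s := V))
  have hu : u ∈ stoneClopen c :=
    mem_stoneClopen_of_mapClusterPt isOpen_interior (mem_interior_iff_mem_nhds.2 hVz) hz hc
  filter_upwards [eventually_mem_of_mem_stoneClopen hu] with x hx
  exact hVN (closure_minimal interior_subset hVc (hcV x hx))

variable [CompactSpace Z] [T2Space Z]

/-- The extension of a continuous map `φ : S → Z` into a compact Hausdorff space to the Stone space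
of the regular open subsets of a space `Y` that contains `S` as a dense subspace: `u` is sent to
the limit of `φ` along the ultrafilter of regular open sets complementary to `u`. -/
noncomputable def regularLimit (hi : IsDenseInducing i) (hφ : Continuous φ)
    (u : MaximalSpectrum (RegularOpenRing Y)) : Z :=
  (exists_tendsto_comap_regularFilter hi hφ u).choose

variable (hi : IsDenseInducing i) (hφ : Continuous φ)

theorem tendsto_regularLimit (u : MaximalSpectrum (RegularOpenRing Y)) :
    Filter.Tendsto φ ((regularFilter u).comap i) (nhds (regularLimit hi hφ u)) :=
  (exists_tendsto_comap_regularFilter hi hφ u).choose_spec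

theorem regularLimit_eq {z : Z} (hu : u ∈ stoneClopen c)
    (hc : ∀ x, i x ∈ (c : Opens Y) → φ x = z) : regularLimit hi hφ u = z :=
  have := neBot_comap_regularFilter hi.dense u
  tendsto_nhds_unique_of_eventuallyEq (tendsto_regularLimit hi hφ u) tendsto_const_nhds
    ((eventually_mem_of_mem_stoneClopen hu).mono hc)

theorem regularLimit_mem_closure {W : Set Z} (hu : u ∈ stoneClopen c)
    (hc : ∀ x, i x ∈ (c : Opens Y) → φ x ∈ closure W) : regularLimit hi hφ u ∈ closure W :=
  have := neBot_comap_regularFilter hi.dense u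
  isClosed_closure.mem_of_tendsto (tendsto_regularLimit hi hφ u)
    ((eventually_mem_of_mem_stoneClopen hu).mono hc)

theorem continuous_regularLimit : Continuous (regularLimit hi hφ) := by
  refine continuous_iff_continuousAt.2 fun u N hN => Filter.mem_map.2 ?_
  obtain ⟨V, hVz, hVc, hVN⟩ := exists_mem_nhds_isClosed_subset hN
  obtain ⟨c, hc, hcV⟩ := exists_regular_preimage hi hφ (isOpen_interior (s := V))
  have := neBot_comap_regularFilter hi.dense u
  have hu : u ∈ stoneClopen c := mem_stoneClopen_of_mapClusterPt isOpen_interior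
    (mem_interior_iff_mem_nhds.2 hVz) (tendsto_regularLimit hi hφ u).mapClusterPt hc
  filter_upwards [(isClopen_stoneClopen c).isOpen.mem_nhds hu] with v hv
  exact hVN (closure_minimal interior_subset hVc (regularLimit_mem_closure hi hφ hv hcV))

theorem regularLimit_surjective (hφd : DenseRange φ) :
    Function.Surjective (regularLimit hi hφ) := by
  have hdense : DenseRange (regularLimit hi hφ) := dense_iff_inter_open.2 fun W hW ⟨z, hz⟩ => by
    obtain ⟨V, hVz, hVc, hVW⟩ := exists_mem_nhds_isClosed_subset (hW.mem_nhds hz)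
    obtain ⟨c, hc, hcV⟩ := exists_regular_preimage hi hφ (isOpen_interior (s := V))
    obtain ⟨x, hx⟩ := hφd.exists_mem_open isOpen_interior ⟨z, mem_interior_iff_mem_nhds.2 hVz⟩
    have hne : c ≠ ⊥ := fun h => by simpa [h] using hc x hx
    obtain ⟨u, hu⟩ := nonempty_stoneClopen hne
    exact ⟨_, hVW (closure_minimal interior_subset hVc (regularLimit_mem_closure hi hφ hu hcV)),
      u, rfl⟩
  rw [← Set.range_eq_univ, ← hdense.closure_range,
    (isCompact_range (continuous_regularLimit hi hφ)).isClosed.closure_eq]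

theorem map_regularLimit {S' Z' : Type*} [TopologicalSpace S'] [TopologicalSpace Z']
    [CompactSpace Z'] [T2Space Z'] {i' : S' → Y} {φ' : S' → Z'} (hi' : IsDenseInducing i')
    (hφ' : Continuous φ') {f : S → S'} {g : Z → Z'} (hg : Continuous g) (hf : i' ∘ f = i)
    (hfg : g ∘ φ = φ' ∘ f) (u : MaximalSpectrum (RegularOpenRing Y)) :
    g (regularLimit hi hφ u) = regularLimit hi' hφ' u := by
  have := neBot_comap_regularFilter hi.dense u
  have hlim : Filter.Tendsto (φ' ∘ f) ((regularFilter u).comap i)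
      (nhds (regularLimit hi' hφ' u)) :=
    (tendsto_regularLimit hi' hφ' u).comp
      (Filter.tendsto_comap_iff.2 (hf ▸ Filter.tendsto_comap))
  exact tendsto_nhds_unique (hfg ▸ (hg.tendsto _).comp (tendsto_regularLimit hi hφ u)) hlim

end RegularLimit

/-! ### The space `K(X)` -/

theorem dense_union_compl_regular {Y : Type u} [TopologicalSpace Y]
    (c : Heyting.Regular (Opens Y)) :
    Dense (((c : Opens Y) : Set Y) ∪ ((cᶜ : Heyting.Regular (Opens Y)) : Opens Y)) := by
  refine dense_iff_inter_open.2 fun N hN ⟨y, hy⟩ => ?_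
  by_contra h
  have hdisj : Disjoint (⟨N, hN⟩ : Opens Y) c :=
    disjoint_iff.2 (Opens.ext (Set.eq_empty_of_forall_notMem fun x hx => h ⟨x, hx.1, Or.inl hx.2⟩))
  exact h ⟨y, hy, Or.inr (hdisj.le_compl_right hy)⟩

theorem exists_dense_isOpen_continuous_bool {Y : Type u} [TopologicalSpace Y]
    (c : Heyting.Regular (Opens Y)) : ∃ S : Set Y, IsOpen S ∧ Dense S ∧
      ∃ f : S → Bool, Continuous f ∧ (∀ x : S, x.1 ∈ (c : Opens Y) → f x = true) ∧
        ∀ x : S, x.1 ∈ ((cᶜ : Heyting.Regular (Opens Y)) : Opens Y) → f x = false := by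
  have hdisj {x : Y} (hx : x ∈ (c : Opens Y)) (hx' : x ∈ (c : Opens Y)ᶜ) : False :=
    Set.disjoint_left.1 (Opens.coe_disjoint.2 disjoint_compl_right) hx hx'
  refine ⟨_, (c : Opens Y).isOpen.union (c : Opens Y)ᶜ.isOpen, dense_union_compl_regular c,
    Set.boolIndicator {x | x.1 ∈ (c : Opens Y)}, ?_,
    fun x hx => (Set.mem_iff_boolIndicator _ x).1 hx,
    fun x hx => (Set.notMem_iff_boolIndicator _ x).1 fun hx' => hdisj hx' hx⟩
  refine (continuous_boolIndicator_iff_isClopen _).2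
    ⟨⟨?_⟩, (c : Opens Y).isOpen.preimage continuous_subtype_val⟩
  convert (c : Opens Y)ᶜ.isOpen.preimage continuous_subtype_val using 1
  exact Set.ext fun x => ⟨x.2.resolve_left, fun hx hx' => hdisj hx' hx⟩

theorem continuous_stoneCechInclusion {Y : Type u} [TopologicalSpace Y] {S T : Set Y}
    (h : S ⊆ T) : Continuous (stoneCechInclusion h) :=
  continuous_stoneCechExtend _

namespace KSpace

variable {X : Type u} [TopologicalSpace X]

instance : T2Space (KSpace X) :=
  inferInstanceAs (T2Space (Subtype _))

/-- The limit of an ultrafilter of regular open subsets of `βX` in `βS`, for a dense subspace `S`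
of `βX`. -/
noncomputable def coordinate {S : Set (StoneCech X)} (hS : Dense S)
    (u : MaximalSpectrum (RegularOpenRing (StoneCech X))) : StoneCech S :=
  regularLimit hS.isDenseInducing_val continuous_stoneCechUnit u

theorem continuous_coordinate {S : Set (StoneCech X)} (hS : Dense S) :
    Continuous (coordinate hS) :=
  continuous_regularLimit hS.isDenseInducing_val continuous_stoneCechUnit

theorem stoneCechInclusion_coordinate {S T : Set (StoneCech X)} (hS : Dense S) (hT : Dense T)
    (h : S ⊆ T) (u : MaximalSpectrum (RegularOpenRing (StoneCech X))) :
    stoneCechInclusion h (coordinate hS u) = coordinate hT u :=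
  map_regularLimit hS.isDenseInducing_val continuous_stoneCechUnit hT.isDenseInducing_val
    continuous_stoneCechUnit (f := Set.inclusion h) (continuous_stoneCechInclusion h) rfl
    (stoneCechExtend_extends _) u

/-- The point of `K(X)` determined by a maximal ideal of regular open subsets of `βX`. -/
noncomputable def ofMaximal (u : MaximalSpectrum (RegularOpenRing (StoneCech X))) : KSpace X :=
  ⟨fun S => coordinate S.2.2 u, fun S T h => stoneCechInclusion_coordinate S.2.2 T.2.2 h u⟩

theorem continuous_ofMaximal : Continuous (ofMaximal (X := X)) :=
  Continuous.subtype_mk (continuous_pi fun S => continuous_coordinate S.2.2) _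

theorem ofMaximal_injective : Function.Injective (ofMaximal (X := X)) := by
  refine fun u v huv => eq_of_forall_mem_stoneClopen fun c hu => ?_
  by_contra hv
  obtain ⟨S, hSo, hS, f, hf, hfc, hfc'⟩ := exists_dense_isOpen_continuous_bool c
  have hextend (w) : stoneCechExtend hf (coordinate hS w) =
      regularLimit hS.isDenseInducing_val hf w :=
    map_regularLimit hS.isDenseInducing_val continuous_stoneCechUnit hS.isDenseInducing_val hf
      (f := id) (continuous_stoneCechExtend hf) rfl (stoneCechExtend_extends hf) w
  have hcoordinate : coordinate hS u = coordinate hS v :=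
    congrFun (congrArg Subtype.val huv) ⟨S, hSo.isGδ, hS⟩
  refine Bool.false_ne_true ?_
  calc false = stoneCechExtend hf (coordinate hS v) :=
        ((hextend v).trans (regularLimit_eq _ _ (mem_stoneClopen_compl_iff.2 hv) hfc')).symm
    _ = stoneCechExtend hf (coordinate hS u) := by rw [hcoordinate]
    _ = true := (hextend u).trans (regularLimit_eq _ _ hu hfc)

theorem ofMaximal_surjective : Function.Surjective (ofMaximal (X := X)) := by
  intro k
  let F (S : {S : Set (StoneCech X) // IsGδ S ∧ Dense S}) := coordinate S.2.2 ⁻¹' {k.1 S}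
  have hclosed (S) : IsClosed (F S) := isClosed_singleton.preimage (continuous_coordinate S.2.2)
  have hmono {S T : {S : Set (StoneCech X) // IsGδ S ∧ Dense S}} (h : S.1 ⊆ T.1) : F S ⊆ F T :=
    fun u hu => by
      change coordinate T.2.2 u = k.1 T
      rw [← stoneCechInclusion_coordinate S.2.2 T.2.2 h, ← k.2 S T h]
      exact congrArg _ hu
  have : Nonempty {S : Set (StoneCech X) // IsGδ S ∧ Dense S} := ⟨Set.univ, .univ, dense_univ⟩
  have hdir : Directed (· ⊇ ·) F := fun S T =>
    ⟨⟨S.1 ∩ T.1, S.2.1.inter T.2.1, Dense.inter_of_Gδ S.2.1 T.2.1 S.2.2 T.2.2⟩,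
      hmono Set.inter_subset_left, hmono Set.inter_subset_right⟩
  obtain ⟨u, hu⟩ := IsCompact.nonempty_iInter_of_directed_nonempty_isCompact_isClosed F hdir
    (fun S => regularLimit_surjective _ _ denseRange_stoneCechUnit (k.1 S))
    (fun S => (hclosed S).isCompact) hclosed
  exact ⟨u, Subtype.ext (funext fun S => Set.mem_iInter.1 hu S)⟩

/-- The homeomorphism of the Stone space of the regular open subsets of `βX` with `K(X)`. -/
noncomputable def homeomorphMaximalSpectrum (X : Type u) [TopologicalSpace X] :
    MaximalSpectrum (RegularOpenRing (StoneCech X)) ≃ₜ KSpace X :=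
  Continuous.homeoOfEquivCompactToT2
    (f := Equiv.ofBijective _ ⟨ofMaximal_injective, ofMaximal_surjective⟩) continuous_ofMaximal

instance : CompactSpace (KSpace X) :=
  (homeomorphMaximalSpectrum X).compactSpace

instance : ExtremallyDisconnected (KSpace X) :=
  have := extremallyDisconnected_maximalSpectrum (α := Heyting.Regular (Opens (StoneCech X)))
    exists_isLUB_regular
  extremallyDisconnected_of_homeo (homeomorphMaximalSpectrum X)

end KSpace

/-! ### The space of maximal ideals of `Q(X)` -/

section QRing

variable (X : Type u) [TopologicalSpace X]

theorem nonempty_maximalSpectrum_regularOpenRing_homeomorph [CompletelyRegularSpace X] :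
    Nonempty (MaximalSpectrum (RegularOpenRing X) ≃ₜ KSpace X) := by
  obtain ⟨e⟩ := nonempty_regularOpens_orderIso (i := ⟨stoneCechUnit, continuous_stoneCechUnit⟩)
    (isDenseInducing_stoneCechUnit (X := X))
  exact ⟨(maximalSpectrumCongr (asBoolRingCongr e)).trans (KSpace.homeomorphMaximalSpectrum X)⟩

theorem isVonNeumannRegular_qRing : IsVonNeumannRegular (QRing X) :=
  MaxQuotientRing.isVonNeumannRegular

theorem nonempty_maximalSpectrum_qRing_homeomorph [CompletelyRegularSpace X] :
    Nonempty (MaximalSpectrum (QRing X) ≃ₜ KSpace X) := by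
  obtain ⟨f⟩ := (isVonNeumannRegular_qRing X).nonempty_maximalSpectrum_homeomorph
  obtain ⟨e⟩ := nonempty_idempotents_qRing_orderIso X
  obtain ⟨g⟩ := nonempty_maximalSpectrum_regularOpenRing_homeomorph X
  exact ⟨f.trans ((maximalSpectrumCongr (asBoolRingCongr e)).trans g)⟩

variable [T35Space X] [SecondCountableTopology X] [Nonempty X]
  (hX : ∀ x : X, ¬ IsOpen ({x} : Set X)) (ι : Type v) [Countable ι] [Infinite ι]
include hX

theorem nonempty_idempotentRing_qRing_ringEquiv :
    Nonempty (IdempotentRing (QRing X) ≃+* MaxQuotientRing (FreeBooleanRing ι)) := by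
  have hB := FreeBooleanRing.isIdempotentElem (ι := ι)
  have := isReduced_of_forall_isIdempotentElem hB
  obtain ⟨e⟩ := nonempty_idempotents_qRing_orderIso X
  obtain ⟨f⟩ := (isCohenAlgebra_regularOpens hX).nonempty_orderIso
    (MaxQuotientRing.isCohenAlgebra_idempotents fun a : FreeBooleanRing ι =>
      FreeBooleanRing.exists_orthogonal_mul_ne_zero)
  exact ⟨(asBoolRingCongr (e.trans f)).trans
    (idempotentRingEquiv (MaxQuotientRing.isIdempotentElem hB))⟩

theorem nonempty_maximalSpectrum_qRing_homeomorph_freeBooleanRing :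
    Nonempty (MaximalSpectrum (QRing X) ≃ₜ
      MaximalSpectrum (MaxQuotientRing (FreeBooleanRing ι))) := by
  obtain ⟨f⟩ := (isVonNeumannRegular_qRing X).nonempty_maximalSpectrum_homeomorph
  obtain ⟨e⟩ := nonempty_idempotentRing_qRing_ringEquiv X hX ι
  exact ⟨f.trans (maximalSpectrumCongr e)⟩

end QRing

theorem mainTheorem10_general :
    (∀ (X : Type u) [TopologicalSpace X],
      CompactSpace (KSpace X) ∧ T2Space (KSpace X) ∧ ExtremallyDisconnected (KSpace X)) ∧
    (∀ (X : Type u) [TopologicalSpace X] [CompletelyRegularSpace X],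
      Nonempty (MaximalSpectrum (RegularOpenRing X) ≃ₜ KSpace X) ∧
      Nonempty (MaximalSpectrum (QRing X) ≃ₜ KSpace X)) ∧
    (∀ (X : Type u) [TopologicalSpace X] [T35Space X] [SecondCountableTopology X] [Nonempty X],
      (∀ x : X, ¬ IsOpen ({x} : Set X)) →
      Nonempty (IdempotentRing (QRing X) ≃+* MaxQuotientRing (FreeBooleanRing ℕ)) ∧
      Nonempty (MaximalSpectrum (QRing X) ≃ₜ
        MaximalSpectrum (MaxQuotientRing (FreeBooleanRing ℕ)))) ∧
    (∀ (X : Type u) [TopologicalSpace X] [T35Space X] [SecondCountableTopology X] [Nonempty X]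
      (Y : Type v) [TopologicalSpace Y] [T35Space Y] [SecondCountableTopology Y] [Nonempty Y],
      (∀ x : X, ¬ IsOpen ({x} : Set X)) → (∀ y : Y, ¬ IsOpen ({y} : Set Y)) →
      Nonempty (IdempotentRing (QRing X) ≃+* IdempotentRing (QRing Y)) ∧
      Nonempty (MaximalSpectrum (QRing X) ≃ₜ MaximalSpectrum (QRing Y))) ∧
    ∀ (B : Type w) [CommRing B], (∀ b : B, IsIdempotentElem b) →
      IsBooleanCompletion (MaxQuotientRing.of B) := by
  refine ⟨fun X _ => ⟨inferInstance, inferInstance, inferInstance⟩,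
    fun X _ _ => ⟨nonempty_maximalSpectrum_regularOpenRing_homeomorph X,
      nonempty_maximalSpectrum_qRing_homeomorph X⟩,
    fun X _ _ _ _ hX => ⟨nonempty_idempotentRing_qRing_ringEquiv X hX ℕ,
      nonempty_maximalSpectrum_qRing_homeomorph_freeBooleanRing X hX ℕ⟩,
    fun X _ _ _ _ Y _ _ _ _ hX hY => ?_, fun B _ hB => MaxQuotientRing.isBooleanCompletion_of hB⟩
  obtain ⟨e⟩ := nonempty_idempotentRing_qRing_ringEquiv X hX ℕ
  obtain ⟨e'⟩ := nonempty_idempotentRing_qRing_ringEquiv Y hY ℕ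
  obtain ⟨f⟩ := nonempty_maximalSpectrum_qRing_homeomorph_freeBooleanRing X hX ℕ
  obtain ⟨f'⟩ := nonempty_maximalSpectrum_qRing_homeomorph_freeBooleanRing Y hY ℕ
  exact ⟨⟨e.trans e'.symm⟩, ⟨f.trans f'.symm⟩⟩

theorem mainTheorem10 :
    (∀ (X : Type u) [TopologicalSpace X] [T35Space X],
      CompactSpace (KSpace X) ∧ T2Space (KSpace X) ∧ ExtremallyDisconnected (KSpace X) ∧
      Nonempty (MaximalSpectrum (RegularOpenRing X) ≃ₜ KSpace X)) ∧
    (∀ (X : Type u) [TopologicalSpace X] [T35Space X] [SecondCountableTopology X] [Nonempty X],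
      (∀ x : X, ¬ IsOpen ({x} : Set X)) →
      Nonempty (IdempotentRing (QRing X) ≃+* MaxQuotientRing (FreeBooleanRing ℕ)) ∧
      Nonempty (MaximalSpectrum (QRing X) ≃ₜ
        MaximalSpectrum (MaxQuotientRing (FreeBooleanRing ℕ))) ∧
      Nonempty (MaximalSpectrum (QRing X) ≃ₜ KSpace X)) ∧
    (∀ (X : Type u) [TopologicalSpace X] [T35Space X] [SecondCountableTopology X] [Nonempty X]
      (Y : Type v) [TopologicalSpace Y] [T35Space Y] [SecondCountableTopology Y] [Nonempty Y],
      (∀ x : X, ¬ IsOpen ({x} : Set X)) → (∀ y : Y, ¬ IsOpen ({y} : Set Y)) →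
      Nonempty (IdempotentRing (QRing X) ≃+* IdempotentRing (QRing Y)) ∧
      Nonempty (MaximalSpectrum (QRing X) ≃ₜ MaximalSpectrum (QRing Y))) ∧
    IsBooleanCompletion (MaxQuotientRing.of (FreeBooleanRing ℕ)) := by
  obtain ⟨hK, hMax, hCohen, hIndep, hCompletion⟩ := mainTheorem10_general.{u, v, 0}
  exact ⟨fun X _ _ => ⟨(hK X).1, (hK X).2.1, (hK X).2.2, (hMax X).1⟩,
    fun X _ _ _ _ hX => ⟨(hCohen X hX).1, (hCohen X hX).2, (hMax X).2⟩, hIndep,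
    hCompletion _ FreeBooleanRing.isIdempotentElem⟩
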